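/- **Theorem 6.8.** Let $n\ge 1$, let $X$ be a locally compact Hausdorff space, and let $\mathcal E$ be a locally trivial bundle over $X$ with fibre $\mathbb M_n$ (the complex $n\times n$ matrices) and structure group $\mathrm{Aut}(\mathbb M_n)=PU(n)$. Let $A=\Gamma_0(\mathcal E)$ be the ($n$-homogeneous) $C^*$-algebra of continuous sections of $\mathcal E$ that vanish at infinity, with pointwise operations and the supremum norm. Let $\mathrm{TM}_0(A)=\{M_{a,b}: a,b\in A\}$, where $M_{a,b}(x)=axb$. Let $\mathrm{IB}(A)$ be the set of bounded linear operators $\phi:A\to A$ with $\phi(I)\subseteq I$ for every closed two-sided ideal $I$ of $A$. For $\phi\in\mathrm{IB}(A)$ and $t\in X$ let $\phi_t:\mathcal E_t\to\mathcal E_t$ be the induced operator, $\phi_t(x(t))=\phi(x)(t)$ for $x\in A$, and let $\mathrm{coz}(\phi)=\{t\in X:\phi_t\ne 0\}$, which is open in $X$. Let $\mathrm{IB}_{0,1}(A)$ be the set of $\phi\in \mathrm{IB}(A)$ such that the function $t\mapsto\|\phi_t\|$ belongs to $C_0(X)$ and, for every $t\in X$, there are $a,b\in\mathcal E_t$ with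 $\phi_t(x)=axb$ for all $x\in \mathcal E_t$. For $\phi\in\mathrm{IB}_{0,1}(A)$ and $U=\mathrm{coz}(\phi)$, let $\mathcal L_\phi$ be the complex line subbundle of $\mathcal E|_U$ whose fibre at $t\in U$ is $\mathbb C a$, where $\phi_t(x)=axb$ for all $x \in \mathcal E_t$ (this line does not depend on the choice of $a,b\in\mathcal E_t$). Then, for every bounded linear operator $\phi$ on $A$, the following are equivalent: (a) $\phi$ belongs to the operator-norm closure of $\mathrm{TM}_0(A)$; (b) $\phi\in\mathrm{IB}_{0,1}(A)$ and, for $U=\mathrm{coz}(\phi)$, the restriction $\mathcal L_\phi|_K$ is a trivial complex line bundle for every compact subset $K\subseteq U$. -/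

import Mathlib

open Bundle Topology Filter Set
open scoped ENNReal ZeroAtInfty ComplexOrder

noncomputable section

namespace MatrixBundle

/-- The C*-algebra `M_n` of complex `n × n` matrices (with the operator norm). -/
abbrev Mat (n : ℕ) : Type := CStarMatrix (Fin n) (Fin n) ℂ

theorem finiteDimensional_fibre {X : Type*} [TopologicalSpace X] (n : ℕ) (E : X → Type*)
    [∀ t, CStarAlgebra (E t)] [TopologicalSpace (TotalSpace (Mat n) E)] [FiberBundle (Mat n) E]
    [VectorBundle ℂ (Mat n) E] (t : X) : FiniteDimensional ℂ (E t) :=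
  haveI : FiniteDimensional ℂ (Mat n) :=
    inferInstanceAs (FiniteDimensional ℂ (Matrix (Fin n) (Fin n) ℂ))
  ((trivializationAt (Mat n) E t).continuousLinearEquivAt ℂ t
    (mem_baseSet_trivializationAt (Mat n) E t)).symm.toLinearEquiv.finiteDimensional

section Bundle

variable {X : Type*} [TopologicalSpace X] (n : ℕ) (E : X → Type*) [∀ t, CStarAlgebra (E t)]
  [TopologicalSpace (TotalSpace (Mat n) E)] [FiberBundle (Mat n) E]

/-- A section of the bundle is continuous if it is so as a map into the total space. -/
def ContinuousSection (s : ∀ t, E t) : Prop :=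
  Continuous fun t => (⟨t, s t⟩ : TotalSpace (Mat n) E)

variable {n E} in
theorem continuousSection_iff {s : ∀ t, E t} : ContinuousSection n E s ↔
    ∀ t₀, ContinuousAt (fun t => (trivializationAt (Mat n) E t₀ ⟨t, s t⟩).2) t₀ := by
  unfold ContinuousSection
  rw [continuous_iff_continuousAt]
  refine forall_congr' fun t₀ => ?_
  rw [FiberBundle.continuousAt_totalSpace]
  exact and_iff_right continuousAt_id

variable [VectorBundle ℂ (Mat n) E]

/-- A locally trivial vector bundle `E` with fibre `M_n`, whose fibres `E t` are C*-algebras, is an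
`M_n`-bundle with structure group `Aut(M_n) = PU(n)` if its (linear, locally trivializing) charts
`E t → M_n` are isomorphisms of `*`-algebras. -/
class IsMatrixBundle : Prop where
  map_mul : ∀ (e : Trivialization (Mat n) (π (Mat n) E)) [MemTrivializationAtlas e],
    ∀ t ∈ e.baseSet, ∀ x y : E t, (e ⟨t, x * y⟩).2 = (e ⟨t, x⟩).2 * (e ⟨t, y⟩).2
  map_star : ∀ (e : Trivialization (Mat n) (π (Mat n) E)) [MemTrivializationAtlas e],
    ∀ t ∈ e.baseSet, ∀ x : E t, (e ⟨t, star x⟩).2 = star (e ⟨t, x⟩).2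

variable [IsMatrixBundle n E]

/-- A chart of an `M_n`-bundle on the fibre over `t`, as a `*`-homomorphism. -/
def chartHom (e : Trivialization (Mat n) (π (Mat n) E)) [MemTrivializationAtlas e] {t : X}
    (ht : t ∈ e.baseSet) : E t →⋆ₙₐ[ℂ] Mat n where
  toFun x := (e ⟨t, x⟩).2
  map_smul' c x := (e.linear ℂ ht).map_smul c x
  map_zero' := (e.linear ℂ ht).map_zero
  map_add' x y := (e.linear ℂ ht).map_add x y
  map_mul' x y := IsMatrixBundle.map_mul e t ht x y
  map_star' x := IsMatrixBundle.map_star e t ht x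

theorem chartHom_injective (e : Trivialization (Mat n) (π (Mat n) E)) [MemTrivializationAtlas e]
    {t : X} (ht : t ∈ e.baseSet) : Function.Injective (chartHom n E e ht) := fun x y h => by
  rw [← e.symm_apply_apply_mk ht x, ← e.symm_apply_apply_mk ht y]
  exact congrArg (e.symm t) h

theorem norm_chart (e : Trivialization (Mat n) (π (Mat n) E)) [MemTrivializationAtlas e]
    {t : X} (ht : t ∈ e.baseSet) (x : E t) : ‖(e ⟨t, x⟩).2‖ = ‖x‖ :=
  NonUnitalStarAlgHom.norm_map (chartHom n E e ht) (chartHom_injective n E e ht) x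

/-- The C*-algebra `Γ₀(E)` of continuous sections of `E` vanishing at infinity, with pointwise
operations and the supremum norm (as a `*`-subalgebra of the algebra `lp E ∞` of all bounded
families `(s t)` with `s t ∈ E t`; a continuous section vanishing at infinity is bounded). -/
def Gamma₀ : NonUnitalStarSubalgebra ℂ (lp E ∞) where
  carrier := {s | ContinuousSection n E s ∧ Tendsto (fun t => ‖s t‖) (cocompact X) (𝓝 0)}
  add_mem' := by
    rintro a b ⟨ha, ha'⟩ ⟨hb, hb'⟩
    refine ⟨?_, ?_⟩
    · rw [continuousSection_iff] at *
      intro t₀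
      refine ((ha t₀).add (hb t₀)).congr ?_
      filter_upwards [(trivializationAt (Mat n) E t₀).open_baseSet.mem_nhds
        (mem_baseSet_trivializationAt (Mat n) E t₀)] with t ht
      exact (map_add (chartHom n E _ ht) (a t) (b t)).symm
    · refine squeeze_zero (fun _ => norm_nonneg _) (fun t => norm_add_le (a t) (b t)) ?_
      simpa using ha'.add hb'
  zero_mem' := by
    refine ⟨?_, ?_⟩
    · rw [continuousSection_iff]
      intro t₀
      refine (continuousAt_const (y := (0 : Mat n))).congr ?_
      filter_upwards [(trivializationAt (Mat n) E t₀).open_baseSet.mem_nhds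
        (mem_baseSet_trivializationAt (Mat n) E t₀)] with t ht
      exact (map_zero (chartHom n E _ ht)).symm
    · refine tendsto_const_nhds.congr fun t => ?_
      exact (norm_zero (E := E t)).symm
  mul_mem' := by
    rintro a b ⟨ha, ha'⟩ ⟨hb, hb'⟩
    refine ⟨?_, ?_⟩
    · rw [continuousSection_iff] at *
      intro t₀
      refine ((ha t₀).mul (hb t₀)).congr ?_
      filter_upwards [(trivializationAt (Mat n) E t₀).open_baseSet.mem_nhds
        (mem_baseSet_trivializationAt (Mat n) E t₀)] with t ht
      exact (map_mul (chartHom n E _ ht) (a t) (b t)).symm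
    · refine squeeze_zero (fun _ => norm_nonneg _) (fun t => norm_mul_le (a t) (b t)) ?_
      simpa using ha'.mul hb'
  smul_mem' := by
    rintro c a ⟨ha, ha'⟩
    refine ⟨?_, ?_⟩
    · rw [continuousSection_iff] at *
      intro t₀
      refine ((ha t₀).const_smul c).congr ?_
      filter_upwards [(trivializationAt (Mat n) E t₀).open_baseSet.mem_nhds
        (mem_baseSet_trivializationAt (Mat n) E t₀)] with t ht
      exact (map_smul (chartHom n E _ ht) c (a t)).symm
    · refine squeeze_zero (fun _ => norm_nonneg _) (fun t => (norm_smul_le c (a t))) ?_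
      simpa using ha'.const_mul ‖c‖
  star_mem' := by
    rintro a ⟨ha, ha'⟩
    refine ⟨?_, ?_⟩
    · rw [continuousSection_iff] at *
      intro t₀
      refine ((ha t₀).star).congr ?_
      filter_upwards [(trivializationAt (Mat n) E t₀).open_baseSet.mem_nhds
        (mem_baseSet_trivializationAt (Mat n) E t₀)] with t ht
      exact (map_star (chartHom n E _ ht) (a t)).symm
    · refine ha'.congr fun t => ?_
      exact (norm_star (a t)).symm

/-- Evaluation `a ↦ a(t)` of sections at a point `t`. -/
def evalAt (t : X) : Gamma₀ n E →ₗ[ℂ] E t where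
  toFun a := (a : lp E ∞) t
  map_add' _ _ := rfl
  map_smul' _ _ := rfl

theorem norm_evalAt_le (t : X) (a : Gamma₀ n E) : ‖evalAt n E t a‖ ≤ ‖a‖ :=
  lp.norm_apply_le_norm ENNReal.top_ne_zero (a : lp E ∞) t

theorem evalAt_surjective [T2Space X] [LocallyCompactSpace X] (t₀ : X) :
    Function.Surjective (evalAt n E t₀) := by
  classical
  intro x
  let e := trivializationAt (Mat n) E t₀
  have ht₀ : t₀ ∈ e.baseSet := mem_baseSet_trivializationAt (Mat n) E t₀
  obtain ⟨K, hK, hKt, hKe⟩ := exists_compact_subset e.open_baseSet ht₀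
  obtain ⟨f, hf1, hf0, -, hfI⟩ := exists_continuous_one_zero_of_isCompact (isCompact_singleton)
    (isOpen_interior (s := K)).isClosed_compl
    (disjoint_compl_right_iff_subset.2 (singleton_subset_iff.2 hKt))
  have hfK : ∀ t, t ∉ K → f t = 0 := fun t ht => hf0 fun h => ht (interior_subset h)
  let y : Mat n := (e ⟨t₀, x⟩).2
  let s : ∀ t, E t := fun t => (f t : ℂ) • e.symm t y
  have hes : ∀ t (ht : t ∈ e.baseSet), (e ⟨t, s t⟩).2 = (f t : ℂ) • y := by
    intro t ht
    have h1 := map_smul (chartHom n E e ht) (f t : ℂ) (e.symm t y)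
    have h2 : chartHom n E e ht (e.symm t y) = y := by
      change (e ⟨t, e.symm t y⟩).2 = y
      rw [e.apply_mk_symm ht y]
    rw [h2] at h1
    exact h1
  have hs0 : ∀ t, t ∉ K → s t = 0 := by
    intro t ht
    simp [s, hfK t ht]
  have hbd : ∀ t, ‖s t‖ ≤ ‖y‖ := by
    intro t
    by_cases ht : t ∈ e.baseSet
    · rw [← norm_chart n E e ht, hes t ht, norm_smul]
      have : ‖(f t : ℂ)‖ ≤ 1 := by
        rw [Complex.norm_real, Real.norm_of_nonneg (hfI t).1]; exact (hfI t).2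
      exact mul_le_of_le_one_left (norm_nonneg _) this
    · rw [hs0 t fun h => ht (hKe h)]; simp
  have hmem : Memℓp s ∞ := memℓp_infty ⟨‖y‖, by rintro _ ⟨t, rfl⟩; exact hbd t⟩
  refine ⟨⟨⟨s, hmem⟩, ?_, ?_⟩, ?_⟩
  · change Continuous fun t => (⟨t, s t⟩ : TotalSpace (Mat n) E)
    rw [continuous_iff_continuousAt]
    intro t₁
    by_cases h1 : t₁ ∈ e.baseSet
    · have : ContinuousAt (fun t => (⟨t, s t⟩ : TotalSpace (Mat n) E)) t₁ ↔ _ :=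
        e.tendsto_nhds_iff (e.mem_source.2 h1)
      rw [this]
      refine ⟨tendsto_id, ?_⟩
      have hc : ContinuousAt (fun t => (f t : ℂ) • y) t₁ := by fun_prop
      have hc' : ContinuousAt (fun t => (e ⟨t, s t⟩).2) t₁ := by
        refine hc.congr ?_
        filter_upwards [e.open_baseSet.mem_nhds h1] with t ht using (hes t ht).symm
      exact hc'
    · have hz : ContinuousSection n E (fun t => (0 : E t)) := (Gamma₀ n E).zero_mem.1
      refine (hz.continuousAt (x := t₁)).congr ?_
      filter_upwards [hK.isClosed.isOpen_compl.mem_nhds fun h => h1 (hKe h)] with t ht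
      rw [hs0 t ht]
  · refine tendsto_const_nhds.congr' ?_
    filter_upwards [hK.compl_mem_cocompact] with t ht
    rw [hs0 t ht, norm_zero]
  · change s t₀ = x
    have : f t₀ = 1 := hf1 rfl
    simp only [s, this, Complex.ofReal_one, one_smul, y]
    exact e.symm_apply_apply_mk ht₀ x

/-- The closed two-sided ideal `I_t = {a : a(t) = 0}` of `Γ₀(E)`. -/
def pointIdeal (t : X) : TwoSidedIdeal (Gamma₀ n E) :=
  TwoSidedIdeal.mk' {a | evalAt n E t a = 0} (map_zero _)
    (fun {a b} ha hb => by
      simp only [mem_ofPred_eq] at *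
      rw [map_add, ha, hb, add_zero])
    (fun {a} ha => by
      simp only [mem_ofPred_eq] at *
      rw [map_neg, ha, neg_zero])
    (fun {a b} hb => by
      change (a : lp E ∞) t * evalAt n E t b = 0
      rw [show evalAt n E t b = 0 from hb, mul_zero])
    (fun {a b} ha => by
      change evalAt n E t a * (b : lp E ∞) t = 0
      rw [show evalAt n E t a = 0 from ha, zero_mul])

theorem mem_pointIdeal (t : X) (a : Gamma₀ n E) : a ∈ pointIdeal n E t ↔ evalAt n E t a = 0 := by
  simp [pointIdeal, TwoSidedIdeal.mem_mk']

theorem isClosed_pointIdeal (t : X) : IsClosed (pointIdeal n E t : Set (Gamma₀ n E)) := by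
  have h : (pointIdeal n E t : Set (Gamma₀ n E)) = evalAt n E t ⁻¹' {0} := by
    ext a; exact mem_pointIdeal n E t a
  rw [h]
  exact isClosed_singleton.preimage
    (AddMonoidHomClass.continuous_of_bound (evalAt n E t) 1
      fun a => by simpa using norm_evalAt_le n E t a)

/-- `IB(A)` for `A = Γ₀(E)`: the bounded linear operators on `A` that preserve all closed two-sided
ideals of `A`. -/
def IB : Set (Gamma₀ n E →L[ℂ] Gamma₀ n E) :=
  {φ | ∀ I : TwoSidedIdeal (Gamma₀ n E), IsClosed (I : Set (Gamma₀ n E)) → ∀ a ∈ I, φ a ∈ I}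

/-- `TM₀(A)` for `A = Γ₀(E)`: the two-sided multiplications `x ↦ a x b` with `a, b ∈ A`. -/
def TM₀ : Set (Gamma₀ n E →L[ℂ] Gamma₀ n E) :=
  {φ | ∃ a b : Gamma₀ n E, ∀ x, φ x = a * x * b}

variable {n E}

theorem ker_evalAt_le {φ : Gamma₀ n E →L[ℂ] Gamma₀ n E} (hφ : φ ∈ IB n E) (t : X) :
    LinearMap.ker (evalAt n E t) ≤
      LinearMap.ker (evalAt n E t ∘ₗ (φ : Gamma₀ n E →ₗ[ℂ] Gamma₀ n E)) := fun a ha =>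
  (mem_pointIdeal n E t _).1
    (hφ _ (isClosed_pointIdeal n E t) a ((mem_pointIdeal n E t a).2 ha))

variable [T2Space X] [LocallyCompactSpace X]

/-- The operator `φ_t` induced by `φ ∈ IB(A)` on `A / I_t`, where `A / I_t` is identified with the
fibre `E t` by evaluation at `t`. -/
def fibreMap (φ : Gamma₀ n E →L[ℂ] Gamma₀ n E) (hφ : φ ∈ IB n E) (t : X) : E t →L[ℂ] E t :=
  haveI := finiteDimensional_fibre n E t
  LinearMap.toContinuousLinearMap
    ((LinearMap.ker (evalAt n E t)).liftQ
        (evalAt n E t ∘ₗ (φ : Gamma₀ n E →ₗ[ℂ] Gamma₀ n E)) (ker_evalAt_le hφ t) ∘ₗ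
      ((evalAt n E t).quotKerEquivOfSurjective (evalAt_surjective n E t)).symm.toLinearMap)

theorem fibreMap_evalAt (φ : Gamma₀ n E →L[ℂ] Gamma₀ n E) (hφ : φ ∈ IB n E) (t : X)
    (a : Gamma₀ n E) : fibreMap φ hφ t (evalAt n E t a) = evalAt n E t (φ a) := by
  have h : ((evalAt n E t).quotKerEquivOfSurjective (evalAt_surjective n E t)).symm
      (evalAt n E t a) = Submodule.Quotient.mk a := by
    rw [LinearEquiv.symm_apply_eq]; rfl
  simp only [fibreMap, LinearMap.coe_toContinuousLinearMap', LinearMap.comp_apply,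
    LinearEquiv.coe_coe, h]
  rfl

variable (n E) in
/-- `IB₁(A)`: those `φ ∈ IB(A)` for which each `φ_t` is a two-sided multiplication `x ↦ a x b`. -/
def IB₁ : Set (Gamma₀ n E →L[ℂ] Gamma₀ n E) :=
  {φ | ∃ hφ : φ ∈ IB n E, ∀ t, ∃ a b : E t, ∀ x, fibreMap φ hφ t x = a * x * b}

variable (n E) in
/-- `IB₀(A)`: those `φ ∈ IB(A)` for which `t ↦ ‖φ_t‖` belongs to `C₀(X)`. -/
def IB₀ : Set (Gamma₀ n E →L[ℂ] Gamma₀ n E) :=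
  {φ | ∃ hφ : φ ∈ IB n E, ∃ f : C₀(X, ℝ), ∀ t, f t = ‖fibreMap φ hφ t‖}

variable (n E) in
/-- `IB₀,₁(A) = IB₀(A) ∩ IB₁(A)`. -/
def IB₀₁ : Set (Gamma₀ n E →L[ℂ] Gamma₀ n E) := IB₀ n E ∩ IB₁ n E

/-- The cozero set of `φ`. -/
def coz (φ : Gamma₀ n E →L[ℂ] Gamma₀ n E) (hφ : φ ∈ IB n E) : Set X :=
  {t | fibreMap φ hφ t ≠ 0}

/-- The fibres of the line bundle `L_φ ⊆ E|_U`, `U = coz φ`, of `φ ∈ IB₁(A)`: if `t ∈ U` and `φ_t`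
is the multiplication `x ↦ a x b`, then the fibre at `t` is the line `ℂ a` (the coefficient `a` is
unique up to a non-zero scalar). Only the fibres at points of `U` are meaningful. -/
def lineBundle (φ : Gamma₀ n E →L[ℂ] Gamma₀ n E) (hφ : φ ∈ IB n E) (t : X) :
    Submodule ℂ (E t) :=
  Submodule.span ℂ {a | ∃ b : E t, ∀ x, fibreMap φ hφ t x = a * x * b}

end Bundle

section Trivial

variable {X : Type*} (n : ℕ) {E : X → Type*} [∀ t, CStarAlgebra (E t)]
  [TopologicalSpace X] [TopologicalSpace (TotalSpace (Mat n) E)]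

/-- A family `L` of subspaces of the fibres of `E`, with the topology of the total space of `E`, is
trivial over `K` as a complex line bundle: there is a homeomorphism of `L|_K` onto `K × ℂ` that
commutes with the projections to `K` and is linear on each fibre. -/
def IsTrivialOn (L : ∀ t, Submodule ℂ (E t)) (K : Set X) : Prop :=
  ∃ h : {p : TotalSpace (Mat n) E // p.proj ∈ K ∧ p.snd ∈ L p.proj} ≃ₜ K × ℂ,
    (∀ p, ((h p).1 : X) = p.1.proj) ∧
      ∀ (t : X) (ht : t ∈ K),
        IsLinearMap ℂ fun ξ : L t => (h ⟨⟨t, (ξ : E t)⟩, ht, ξ.2⟩).2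

end Trivial

end MatrixBundle

end

/-! The proof recovers the coefficients of a two-sided multiplication from the operator itself.
Since ∑ e_ij x e_ji = tr(x) 1, an operator T = a · b on M_n satisfies ∑ T(e_ij) c e_ji = tr(bc) a,
and ∑ e_ij c T(e_ji) = tr(ca) b (`leftCoeff_eq`, `rightCoeff_eq`). The left sides are continuous in
T and c, whereas for T ≠ 0 the pair (a, b) is determined only up to reciprocal scalars.

Let φ be a norm limit of multiplications. Passing to fibres does not increase norms, so each φ_t is
a limit of multiplications on M_n, hence a multiplication (`isClosed_setOf_mul`), and ‖φ_t‖ vanishes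
at infinity. On a compact K ⊆ coz(φ) the norms ‖φ_t‖ are bounded below. If φ_t = a_t · b_t and
M_{a',b'} is close enough to φ, then b_t is not Hilbert-Schmidt orthogonal to b'(t) for t in K
(`exists_matTrace_mul_star_ne_zero`), so tr(b_t b'(t)*) a_t is a continuous section spanning L_φ
over K.

Conversely, for ε > 0 the set K = {‖φ_t‖ ≥ ε} is compact. A nowhere vanishing section s of L_φ over
K gives φ_t = s(t) · b(t), where b is continuous as well (`continuousOn_right_of_left`). Damping s
and b by a function that vanishes off K extends them to sections in A, and the resulting
multiplication is within ε of φ. -/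

set_option linter.unusedSectionVars false

noncomputable section

namespace MatrixBundle

/-! ### Two-sided multiplications on M_n and their coefficients. -/

section Matrix

variable {n : ℕ}

instance : FiniteDimensional ℂ (Mat n) :=
  inferInstanceAs (FiniteDimensional ℂ (Matrix (Fin n) (Fin n) ℂ))

/-- The matrix unit `e_{ij}` of `M_n`. -/
def matUnit (i j : Fin n) : Mat n := CStarMatrix.ofMatrix (Matrix.single i j 1)

/-- The trace on `M_n`. -/
def matTrace : Mat n →ₗ[ℂ] ℂ :=
  Matrix.traceLinearMap (Fin n) ℂ ℂ ∘ₗ (CStarMatrix.ofMatrixₗ (R := ℂ)).symm.toLinearMap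

theorem matTrace_apply (x : Mat n) : matTrace x = ∑ i, x i i := rfl

theorem matTrace_mul_comm (x y : Mat n) : matTrace (x * y) = matTrace (y * x) :=
  Matrix.trace_mul_comm (CStarMatrix.ofMatrix.symm x) (CStarMatrix.ofMatrix.symm y)

theorem continuous_matTrace : Continuous (matTrace : Mat n → ℂ) :=
  LinearMap.continuous_of_finiteDimensional _

theorem sum_smul_matUnit (x : Mat n) : ∑ i, ∑ j, x i j • matUnit i j = x := by
  have h : ∀ i j, x i j • matUnit i j =
      CStarMatrix.ofMatrix (Matrix.single i j (x i j)) := fun i j =>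
    (Matrix.smul_single (x i j) i j (1 : ℂ)).trans (by rw [smul_eq_mul, mul_one]; rfl)
  simp only [h]
  exact (Matrix.matrix_eq_sum_single (CStarMatrix.ofMatrix.symm x)).symm

theorem matUnit_mul_mul_matUnit (i j k l : Fin n) (x : Mat n) :
    matUnit i j * x * matUnit k l = x j k • matUnit i l :=
  (Matrix.single_mul_mul_single (i' := j) (j' := k) i l (1 : ℂ)
    (CStarMatrix.ofMatrix.symm x) (1 : ℂ)).trans <| by
    rw [one_mul, mul_one]
    refine Eq.trans ?_ (Matrix.smul_single (x j k) i l (1 : ℂ)).symm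
    rw [smul_eq_mul, mul_one]
    rfl

theorem matUnit_mul_matUnit (i j k l : Fin n) :
    matUnit i j * matUnit k l = if j = k then matUnit i l else 0 := by
  have h := matUnit_mul_mul_matUnit i j k l 1
  rw [mul_one] at h
  rw [h, CStarMatrix.one_apply]
  split_ifs <;> simp

theorem sum_matUnit_self : ∑ i, matUnit i i = (1 : Mat n) := by
  rw [← sum_smul_matUnit (1 : Mat n)]
  refine Finset.sum_congr rfl fun i _ => ?_
  rw [Finset.sum_eq_single i]
  · rw [CStarMatrix.one_apply_eq, one_smul]
  · intro j _ h
    rw [CStarMatrix.one_apply_ne h.symm, zero_smul]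
  · simp

/-- This averaging identity is the source of `leftCoeff` and `rightCoeff`, and of the invariance of
the trace. -/
theorem sum_matUnit_mul_mul_matUnit (x : Mat n) :
    ∑ i, ∑ j, matUnit i j * x * matUnit j i = matTrace x • 1 := by
  simp only [matUnit_mul_mul_matUnit, matTrace_apply, ← Finset.sum_smul, ← Finset.smul_sum,
    sum_matUnit_self]

theorem matTrace_star_mul_self (x : Mat n) :
    matTrace (star x * x) = ((∑ i, ∑ j, ‖x j i‖ ^ 2 : ℝ) : ℂ) := by
  push_cast
  rw [matTrace_apply]
  refine Finset.sum_congr rfl fun i _ => ?_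
  rw [CStarMatrix.mul_apply]
  refine Finset.sum_congr rfl fun j _ => ?_
  rw [CStarMatrix.star_apply, ← Complex.conj_mul']
  rfl

theorem matTrace_star_mul_self_eq_zero {x : Mat n} : matTrace (star x * x) = 0 ↔ x = 0 := by
  rw [matTrace_star_mul_self, Complex.ofReal_eq_zero]
  refine ⟨fun h => ?_, fun h => by simp [h]⟩
  rw [Finset.sum_eq_zero_iff_of_nonneg fun i _ => by positivity] at h
  ext j i
  have := h i (Finset.mem_univ i)
  rw [Finset.sum_eq_zero_iff_of_nonneg fun i _ => by positivity] at this
  simpa using this j (Finset.mem_univ j)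

/-- The Hilbert-Schmidt norm dominates the operator norm up to a constant. -/
theorem exists_sq_norm_le_matTrace (n : ℕ) :
    ∃ D : ℝ, 0 < D ∧ ∀ x : Mat n, ‖x‖ ^ 2 ≤ D * ‖matTrace (star x * x)‖ := by
  let S : ℝ := ∑ i : Fin n, ∑ j : Fin n, ‖(matUnit i j : Mat n)‖
  have hS : 0 ≤ S := by positivity
  -- The summand 1 only keeps the constant positive when n = 0.
  refine ⟨S ^ 2 + 1, by positivity, fun x => ?_⟩
  rw [matTrace_star_mul_self, Complex.norm_real, Real.norm_of_nonneg (by positivity)]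
  set q : ℝ := ∑ i, ∑ j, ‖x j i‖ ^ 2
  have hq : 0 ≤ q := by positivity
  have hx : ∀ i j, ‖x i j‖ ≤ √q := fun i j => by
    refine Real.le_sqrt_of_sq_le ?_
    refine le_trans ?_ (Finset.single_le_sum (f := fun j => ∑ i, ‖x i j‖ ^ 2)
      (fun _ _ => by positivity) (Finset.mem_univ j))
    exact Finset.single_le_sum (f := fun i => ‖x i j‖ ^ 2)
      (fun _ _ => by positivity) (Finset.mem_univ i)
  have h : ‖x‖ ≤ √q * S := by
    conv_lhs => rw [← sum_smul_matUnit x]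
    simp only [S, Finset.mul_sum]
    refine (norm_sum_le _ _).trans (Finset.sum_le_sum fun i _ => (norm_sum_le _ _).trans
      (Finset.sum_le_sum fun j _ => ?_))
    rw [norm_smul]
    gcongr
    exact hx i j
  calc ‖x‖ ^ 2 ≤ (√q * S) ^ 2 := by gcongr
    _ = S ^ 2 * q := by rw [mul_pow, Real.sq_sqrt hq, mul_comm]
    _ ≤ (S ^ 2 + 1) * q := by gcongr; linarith

/-- The trace is invariant under automorphisms of `M_n`. -/
theorem matTrace_map_of_mul [NeZero n] (σ : Mat n →ₗ[ℂ] Mat n) (hσ : Function.Surjective σ)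
    (hmul : ∀ x y, σ (x * y) = σ x * σ y) (x : Mat n) : matTrace (σ x) = matTrace x := by
  have h1 : σ 1 = 1 := by
    obtain ⟨y, hy⟩ := hσ 1
    rw [← mul_one (σ 1)]
    nth_rw 2 [← hy]
    rw [← hmul, one_mul, hy]
  have ht1 : matTrace (1 : Mat n) = n := by simp [matTrace_apply]
  -- Under tr ∘ σ the right side becomes n tr(x). By cyclicity of the trace each summand on the left
  -- becomes tr(σ(x e_jj)), so the left side is n tr(σ x).
  have h := congrArg (fun y => matTrace (σ y)) (sum_matUnit_mul_mul_matUnit x)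
  simp only [map_sum, map_smul, h1, ht1] at h
  have h2 : ∀ i j : Fin n, matTrace (σ (matUnit i j * x * matUnit j i)) =
      matTrace (σ (x * matUnit j j)) := fun i j => by
    rw [mul_assoc, hmul, matTrace_mul_comm, ← hmul, mul_assoc, matUnit_mul_matUnit, if_pos rfl]
  have h3 : ∑ j, matTrace (σ (x * matUnit j j)) = matTrace (σ x) := by
    simp only [← map_sum, ← Finset.mul_sum, sum_matUnit_self, mul_one]
  simp only [h2, h3, Finset.sum_const, Finset.card_univ, Fintype.card_fin, nsmul_eq_mul,
    smul_eq_mul] at h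
  rw [mul_comm] at h
  exact mul_right_cancel₀ (Nat.cast_ne_zero.2 (NeZero.ne n)) h

/-- For `T = a · b` this is `tr(bc) a`. -/
def leftCoeff (T : Mat n →L[ℂ] Mat n) (c : Mat n) : Mat n :=
  ∑ i, ∑ j, T (matUnit i j) * c * matUnit j i

/-- For `T = a · b` this is `tr(ca) b`. -/
def rightCoeff (T : Mat n →L[ℂ] Mat n) (c : Mat n) : Mat n :=
  ∑ i, ∑ j, matUnit i j * c * T (matUnit j i)

theorem leftCoeff_eq {T : Mat n →L[ℂ] Mat n} {a b : Mat n} (h : ∀ x, T x = a * x * b)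
    (c : Mat n) : leftCoeff T c = matTrace (b * c) • a := by
  rw [← mul_one a, ← mul_smul_comm, ← sum_matUnit_mul_mul_matUnit]
  simp only [leftCoeff, h, Finset.mul_sum, mul_assoc]

theorem rightCoeff_eq {T : Mat n →L[ℂ] Mat n} {a b : Mat n} (h : ∀ x, T x = a * x * b)
    (c : Mat n) : rightCoeff T c = matTrace (c * a) • b := by
  rw [← one_mul b, ← smul_mul_assoc, ← sum_matUnit_mul_mul_matUnit]
  simp only [rightCoeff, h, Finset.sum_mul, mul_assoc]

theorem leftCoeff_sub (S T : Mat n →L[ℂ] Mat n) (c : Mat n) :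
    leftCoeff (S - T) c = leftCoeff S c - leftCoeff T c := by
  simp [leftCoeff, sub_mul]

theorem tendsto_leftCoeff {α : Type*} {l : Filter α} {f : α → (Mat n →L[ℂ] Mat n)}
    {g : α → Mat n} {T : Mat n →L[ℂ] Mat n} {c : Mat n} (hf : Tendsto f l (𝓝 T))
    (hg : Tendsto g l (𝓝 c)) :
    Tendsto (fun a => leftCoeff (f a) (g a)) l (𝓝 (leftCoeff T c)) := by
  refine tendsto_finsetSum _ fun i _ => tendsto_finsetSum _ fun j _ => ?_
  have := ((ContinuousLinearMap.apply ℂ (Mat n) (matUnit i j)).continuous.tendsto _).comp hf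
  exact (this.mul hg).mul tendsto_const_nhds

theorem tendsto_rightCoeff {α : Type*} {l : Filter α} {f : α → (Mat n →L[ℂ] Mat n)}
    {g : α → Mat n} {T : Mat n →L[ℂ] Mat n} {c : Mat n} (hf : Tendsto f l (𝓝 T))
    (hg : Tendsto g l (𝓝 c)) :
    Tendsto (fun a => rightCoeff (f a) (g a)) l (𝓝 (rightCoeff T c)) := by
  refine tendsto_finsetSum _ fun i _ => tendsto_finsetSum _ fun j _ => ?_
  have := ((ContinuousLinearMap.apply ℂ (Mat n) (matUnit j i)).continuous.tendsto _).comp hf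
  exact (tendsto_const_nhds.mul hg).mul this

theorem exists_norm_leftCoeff_le (n : ℕ) :
    ∃ C : ℝ, 0 < C ∧ ∀ (T : Mat n →L[ℂ] Mat n) (c : Mat n),
      ‖leftCoeff T c‖ ≤ C * ‖T‖ * ‖c‖ := by
  let S : ℝ := ∑ i : Fin n, ∑ j : Fin n, ‖(matUnit i j : Mat n)‖ * ‖(matUnit j i : Mat n)‖
  have hS : 0 ≤ S := by positivity
  refine ⟨S + 1, by positivity, fun T c => ?_⟩
  have : ‖leftCoeff T c‖ ≤ S * (‖T‖ * ‖c‖) := by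
    simp only [S, Finset.sum_mul]
    refine (norm_sum_le _ _).trans (Finset.sum_le_sum fun i _ => (norm_sum_le _ _).trans
      (Finset.sum_le_sum fun j _ => ?_))
    calc _ ≤ ‖T (matUnit i j)‖ * ‖c‖ * ‖(matUnit j i : Mat n)‖ :=
          (norm_mul_le _ _).trans (by gcongr; exact norm_mul_le _ _)
      _ ≤ ‖T‖ * ‖(matUnit i j : Mat n)‖ * ‖c‖ * ‖(matUnit j i : Mat n)‖ := by
          gcongr; exact T.le_opNorm _
      _ = _ := by ring
  refine this.trans ?_
  rw [mul_assoc]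
  gcongr
  linarith

/-- Multiplying `leftCoeff T (matUnit k l)` by a matrix unit on the right isolates the single value
T(e_pl), up to a matrix unit. Here T is arbitrary, not assumed to be a multiplication. -/
theorem eq_zero_of_leftCoeff_eq_zero {T : Mat n →L[ℂ] Mat n} (h : ∀ c, leftCoeff T c = 0) :
    T = 0 := by
  have key : ∀ p l : Fin n, T (matUnit p l) = 0 := by
    intro p l
    have h1 : ∀ q k : Fin n, leftCoeff T (matUnit k l) * matUnit p q =
        T (matUnit p l) * matUnit k q := by
      intro q k
      simp only [leftCoeff, Finset.sum_mul, mul_assoc, matUnit_mul_matUnit]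
      rw [Finset.sum_eq_single p, Finset.sum_eq_single l]
      · simp [matUnit_mul_matUnit]
      · intro j _ hj
        simp [hj.symm]
      · simp
      · intro i _ hi
        refine Finset.sum_eq_zero fun j _ => ?_
        split_ifs <;> simp [matUnit_mul_matUnit, hi]
      · simp
    rw [← mul_one (T (matUnit p l)), ← sum_matUnit_self, Finset.mul_sum]
    refine Finset.sum_eq_zero fun k _ => ?_
    rw [← h1, h, zero_mul]
  ext1 x
  rw [← sum_smul_matUnit x]
  simp [key]

/-- For T = a · b both sides equal tr(bc) tr(da) axb. The right-hand condition mentions no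
coefficients and consists of equations continuous in T, which makes closedness visible. -/
theorem exists_mul_iff (T : Mat n →L[ℂ] Mat n) : (∃ a b, ∀ x, T x = a * x * b) ↔
    ∀ c d x, leftCoeff T c * x * rightCoeff T d = matTrace (d * leftCoeff T c) • T x := by
  constructor
  · rintro ⟨a, b, h⟩ c d x
    rw [leftCoeff_eq h, rightCoeff_eq h, h]
    simp only [smul_mul_assoc, mul_smul_comm, map_smul, smul_smul, smul_eq_mul]
    rw [mul_comm]
  · intro h
    by_cases hT : ∀ c, leftCoeff T c = 0
    · exact ⟨0, 0, fun x => by simp [eq_zero_of_leftCoeff_eq_zero hT]⟩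
    · push Not at hT
      obtain ⟨c, hc⟩ := hT
      -- With d the adjoint of the non-zero left coefficient, the scalar in the identity is a
      -- non-zero Hilbert-Schmidt square and can be divided out.
      have hd := mt matTrace_star_mul_self_eq_zero.1 hc
      refine ⟨(matTrace (star (leftCoeff T c) * leftCoeff T c))⁻¹ • leftCoeff T c,
        rightCoeff T (star (leftCoeff T c)), fun x => ?_⟩
      rw [smul_mul_assoc, smul_mul_assoc, h, smul_smul, inv_mul_cancel₀ hd, one_smul]

/-- The two-sided multiplications on `M_n` form a closed set of operators. -/
theorem isClosed_setOf_mul (n : ℕ) :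
    IsClosed {T : Mat n →L[ℂ] Mat n | ∃ a b, ∀ x, T x = a * x * b} := by
  have h : {T : Mat n →L[ℂ] Mat n | ∃ a b, ∀ x, T x = a * x * b} =
      ⋂ c, ⋂ d, ⋂ x, {T : Mat n →L[ℂ] Mat n |
        leftCoeff T c * x * rightCoeff T d = matTrace (d * leftCoeff T c) • T x} := by
    ext T
    simp only [mem_iInter]
    exact exists_mul_iff T
  rw [h]
  refine isClosed_iInter fun c => isClosed_iInter fun d => isClosed_iInter fun x => ?_
  have h1 : Continuous fun T : Mat n →L[ℂ] Mat n => leftCoeff T c :=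
    continuous_iff_continuousAt.2 fun T => tendsto_leftCoeff tendsto_id tendsto_const_nhds
  have h2 : Continuous fun T : Mat n →L[ℂ] Mat n => rightCoeff T d :=
    continuous_iff_continuousAt.2 fun T => tendsto_rightCoeff tendsto_id tendsto_const_nhds
  have h3 : Continuous fun T : Mat n →L[ℂ] Mat n => T x :=
    (ContinuousLinearMap.apply ℂ (Mat n) x).continuous
  have h4 : Continuous fun T : Mat n →L[ℂ] Mat n => leftCoeff T c * x * rightCoeff T d :=
    (h1.mul continuous_const).mul h2
  have h5 : Continuous fun T : Mat n →L[ℂ] Mat n => matTrace (d * leftCoeff T c) :=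
    continuous_matTrace.comp (continuous_const.mul h1)
  have h6 : Continuous fun T : Mat n →L[ℂ] Mat n => matTrace (d * leftCoeff T c) • T x :=
    h5.smul h3
  exact isClosed_eq h4 h6

/-- The left coefficient of a non-zero two-sided multiplication is unique up to a scalar. -/
theorem exists_smul_eq_of_mul_eq {T : Mat n →L[ℂ] Mat n} (hT : T ≠ 0) {a b a' b' : Mat n}
    (h : ∀ x, T x = a * x * b) (h' : ∀ x, T x = a' * x * b') : ∃ r : ℂ, a' = r • a := by
  have hb' : b' ≠ 0 := by
    rintro rfl
    exact hT (ContinuousLinearMap.ext fun x => by rw [h', mul_zero]; rfl)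
  have h1 := leftCoeff_eq h (star b')
  rw [leftCoeff_eq h'] at h1
  have h2 : matTrace (b' * star b') ≠ 0 := by
    rw [matTrace_mul_comm]
    exact mt matTrace_star_mul_self_eq_zero.1 hb'
  refine ⟨(matTrace (b' * star b'))⁻¹ * matTrace (b * star b'), ?_⟩
  rw [mul_smul, ← h1, smul_smul, inv_mul_cancel₀ h2, one_smul]

end Matrix

/-! ### Expressing fibre operators and the fibre trace in charts. -/

section Charts

variable {X : Type*} [TopologicalSpace X] {n : ℕ} {E : X → Type*} [∀ t, CStarAlgebra (E t)]
  [TopologicalSpace (TotalSpace (Mat n) E)] [FiberBundle (Mat n) E]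

/-- A general filter below 𝓝 t₀ lets the same statement serve continuity at a point and continuity
within a compact set. -/
theorem tendsto_mk_iff (e : Trivialization (Mat n) (π (Mat n) E)) {t₀ : X} (ht₀ : t₀ ∈ e.baseSet)
    {l : Filter X} (hl : l ≤ 𝓝 t₀) {s : ∀ t, E t} {x : E t₀} :
    Tendsto (fun t => (⟨t, s t⟩ : TotalSpace (Mat n) E)) l (𝓝 ⟨t₀, x⟩) ↔
      Tendsto (fun t => (e ⟨t, s t⟩).2) l (𝓝 (e ⟨t₀, x⟩).2) := by
  have h : Tendsto (fun t => (⟨t, s t⟩ : TotalSpace (Mat n) E)) l (𝓝 ⟨t₀, x⟩) ↔ _ :=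
    e.tendsto_nhds_iff (e.mem_source.2 ht₀)
  rw [h]
  exact and_iff_right hl

variable [VectorBundle ℂ (Mat n) E]

theorem chart_symm (e : Trivialization (Mat n) (π (Mat n) E)) {t : X} (ht : t ∈ e.baseSet)
    (y : Mat n) : (e ⟨t, e.symm t y⟩).2 = y := by
  rw [e.apply_mk_symm ht y]

theorem chart_smul (e : Trivialization (Mat n) (π (Mat n) E)) [MemTrivializationAtlas e] {t : X}
    (ht : t ∈ e.baseSet) (c : ℂ) (x : E t) : (e ⟨t, c • x⟩).2 = c • (e ⟨t, x⟩).2 :=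
  (e.linear ℂ ht).map_smul c x

theorem chart_zero (e : Trivialization (Mat n) (π (Mat n) E)) [MemTrivializationAtlas e] {t : X}
    (ht : t ∈ e.baseSet) : (e ⟨t, 0⟩).2 = 0 :=
  (e.linear ℂ ht).map_zero

theorem chart_injective (e : Trivialization (Mat n) (π (Mat n) E)) {t : X}
    (ht : t ∈ e.baseSet) {x y : E t} (h : (e ⟨t, x⟩).2 = (e ⟨t, y⟩).2) : x = y := by
  rw [← e.symm_apply_apply_mk ht x, ← e.symm_apply_apply_mk ht y]
  exact congrArg (e.symm t) h

/-- The expression of an operator on the fibre `E t` in a chart. -/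
def chartOp (e : Trivialization (Mat n) (π (Mat n) E)) [MemTrivializationAtlas e] (t : X)
    (T : E t →L[ℂ] E t) : Mat n →L[ℂ] Mat n :=
  (e.continuousLinearMapAt ℂ t).comp (T.comp (e.symmL ℂ t))

theorem chartOp_apply (e : Trivialization (Mat n) (π (Mat n) E)) [MemTrivializationAtlas e] {t : X}
    (ht : t ∈ e.baseSet) (T : E t →L[ℂ] E t) (y : Mat n) :
    chartOp e t T y = (e ⟨t, T (e.symm t y)⟩).2 := by
  simp only [chartOp, ContinuousLinearMap.comp_apply]
  rw [e.symmL_apply ht]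
  exact Trivialization.continuousLinearMapAt_apply_of_mem ℂ e ht _

theorem chartOp_chart (e : Trivialization (Mat n) (π (Mat n) E)) [MemTrivializationAtlas e] {t : X}
    (ht : t ∈ e.baseSet) (T : E t →L[ℂ] E t) (x : E t) :
    chartOp e t T (e ⟨t, x⟩).2 = (e ⟨t, T x⟩).2 := by
  rw [chartOp_apply e ht, e.symm_apply_apply_mk ht x]

theorem chartOp_sub (e : Trivialization (Mat n) (π (Mat n) E)) [MemTrivializationAtlas e] {t : X}
    (S T : E t →L[ℂ] E t) : chartOp e t (S - T) = chartOp e t S - chartOp e t T := by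
  simp [chartOp]

variable [IsMatrixBundle n E]

theorem norm_chartOp (e : Trivialization (Mat n) (π (Mat n) E)) [MemTrivializationAtlas e] {t : X}
    (ht : t ∈ e.baseSet) (T : E t →L[ℂ] E t) : ‖chartOp e t T‖ = ‖T‖ := by
  refine le_antisymm (ContinuousLinearMap.opNorm_le_bound _
    (ContinuousLinearMap.opNorm_nonneg _) fun y => ?_)
    (ContinuousLinearMap.opNorm_le_bound _ (ContinuousLinearMap.opNorm_nonneg _) fun x => ?_)
  · rw [chartOp_apply e ht, norm_chart n E e ht]
    refine (T.le_opNorm _).trans_eq ?_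
    rw [← norm_chart n E e ht, chart_symm e ht]
  · rw [← norm_chart n E e ht, ← norm_chart n E e ht x, ← chartOp_chart e ht]
    exact ContinuousLinearMap.le_opNorm _ _

theorem chartOp_mul (e : Trivialization (Mat n) (π (Mat n) E)) [MemTrivializationAtlas e] {t : X}
    (ht : t ∈ e.baseSet) {T : E t →L[ℂ] E t} {a b : E t} (h : ∀ x, T x = a * x * b) (y : Mat n) :
    chartOp e t T y = (e ⟨t, a⟩).2 * y * (e ⟨t, b⟩).2 := by
  rw [chartOp_apply e ht, h, IsMatrixBundle.map_mul e t ht, IsMatrixBundle.map_mul e t ht,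
    chart_symm e ht]

theorem exists_mul_of_chartOp (e : Trivialization (Mat n) (π (Mat n) E))
    [MemTrivializationAtlas e] {t : X} (ht : t ∈ e.baseSet) {T : E t →L[ℂ] E t}
    (h : ∃ a b, ∀ y, chartOp e t T y = a * y * b) : ∃ a b : E t, ∀ x, T x = a * x * b := by
  obtain ⟨a, b, h⟩ := h
  refine ⟨e.symm t a, e.symm t b, fun x => chart_injective e ht ?_⟩
  rw [← chartOp_chart e ht, h, IsMatrixBundle.map_mul e t ht, IsMatrixBundle.map_mul e t ht,
    chart_symm e ht, chart_symm e ht]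

/-- The trace on the fibre `E t`. -/
def fibreTrace (n : ℕ) {E : X → Type*} [∀ t, CStarAlgebra (E t)]
    [TopologicalSpace (TotalSpace (Mat n) E)] [FiberBundle (Mat n) E] [VectorBundle ℂ (Mat n) E]
    (t : X) : E t →ₗ[ℂ] ℂ :=
  matTrace ∘ₗ ((trivializationAt (Mat n) E t).continuousLinearMapAt ℂ t).toLinearMap

/-- The transition map between two charts is an automorphism of M_n, so it preserves the trace; the
chart chosen in the definition of `fibreTrace` is immaterial. -/
theorem fibreTrace_eq [NeZero n] (e : Trivialization (Mat n) (π (Mat n) E))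
    [MemTrivializationAtlas e] {t : X} (ht : t ∈ e.baseSet) (x : E t) :
    fibreTrace n t x = matTrace (e ⟨t, x⟩).2 := by
  have ht' := mem_baseSet_trivializationAt (Mat n) E t
  let σ : Mat n →ₗ[ℂ] Mat n :=
    ((trivializationAt (Mat n) E t).continuousLinearMapAt ℂ t).toLinearMap ∘ₗ
      (e.symmL ℂ t).toLinearMap
  have hσ : ∀ y, σ y = (trivializationAt (Mat n) E t ⟨t, e.symm t y⟩).2 := fun y => by
    change (trivializationAt (Mat n) E t).continuousLinearMapAt ℂ t (e.symmL ℂ t y) = _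
    rw [e.symmL_apply ht]
    exact Trivialization.continuousLinearMapAt_apply_of_mem ℂ _ ht' _
  have h := matTrace_map_of_mul σ (fun y => ?_) (fun y z => ?_) (e ⟨t, x⟩).2
  · rw [← h, hσ, e.symm_apply_apply_mk ht x]
    exact congrArg matTrace (Trivialization.continuousLinearMapAt_apply_of_mem ℂ _ ht' x)
  · refine ⟨(e ⟨t, (trivializationAt (Mat n) E t).symm t y⟩).2, ?_⟩
    rw [hσ, e.symm_apply_apply_mk ht, chart_symm _ ht']
  · rw [hσ, hσ, hσ, ← IsMatrixBundle.map_mul _ t ht']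
    refine congrArg (fun u : E t => (trivializationAt (Mat n) E t ⟨t, u⟩).2)
      (chart_injective e ht ?_)
    rw [IsMatrixBundle.map_mul e t ht, chart_symm e ht, chart_symm e ht, chart_symm e ht]

theorem fibreTrace_star_mul_self_ne_zero [NeZero n] {t : X} {x : E t} (hx : x ≠ 0) :
    fibreTrace n t (star x * x) ≠ 0 := by
  have ht := mem_baseSet_trivializationAt (Mat n) E t
  rw [fibreTrace_eq _ ht, IsMatrixBundle.map_mul _ t ht, IsMatrixBundle.map_star _ t ht]
  refine mt matTrace_star_mul_self_eq_zero.1 fun h => hx (chart_injective _ ht ?_)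
  rw [h, chart_zero _ ht]

/-- The left coefficient of a non-zero two-sided multiplication on a fibre is unique up to a
scalar. -/
theorem exists_smul_eq_of_fibre_mul_eq (n : ℕ) {E : X → Type*} [∀ t, CStarAlgebra (E t)]
    [TopologicalSpace (TotalSpace (Mat n) E)] [FiberBundle (Mat n) E] [VectorBundle ℂ (Mat n) E]
    [IsMatrixBundle n E] {t : X} {T : E t →L[ℂ] E t} (hT : T ≠ 0)
    {a b a' b' : E t} (h : ∀ x, T x = a * x * b) (h' : ∀ x, T x = a' * x * b') :
    ∃ r : ℂ, a' = r • a := by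
  have ht := mem_baseSet_trivializationAt (Mat n) E t
  have hT' : chartOp (trivializationAt (Mat n) E t) t T ≠ 0 := by
    refine fun h0 => hT (ContinuousLinearMap.ext fun x => chart_injective _ ht ?_)
    rw [← chartOp_chart _ ht, h0]
    exact (chart_zero _ ht).symm
  obtain ⟨r, hr⟩ := exists_smul_eq_of_mul_eq hT' (chartOp_mul _ ht h) (chartOp_mul _ ht h')
  exact ⟨r, chart_injective _ ht (by rw [hr, chart_smul _ ht])⟩

end Charts

/-! ### Constructing sections in Γ₀(E). -/

section Sections

variable {X : Type*} [TopologicalSpace X] {n : ℕ} {E : X → Type*} [∀ t, CStarAlgebra (E t)]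
  [TopologicalSpace (TotalSpace (Mat n) E)] [FiberBundle (Mat n) E] [VectorBundle ℂ (Mat n) E]
  [IsMatrixBundle n E]

theorem tendsto_norm_of_tendsto_mk {t₀ : X} {l : Filter X} (hl : l ≤ 𝓝 t₀) {s : ∀ t, E t}
    {x : E t₀} (h : Tendsto (fun t => (⟨t, s t⟩ : TotalSpace (Mat n) E)) l (𝓝 ⟨t₀, x⟩)) :
    Tendsto (fun t => ‖s t‖) l (𝓝 ‖x‖) := by
  let e := trivializationAt (Mat n) E t₀
  have ht₀ : t₀ ∈ e.baseSet := mem_baseSet_trivializationAt (Mat n) E t₀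
  have h' := ((tendsto_mk_iff e ht₀ hl).1 h).norm
  rw [norm_chart n E e ht₀] at h'
  refine h'.congr' ?_
  filter_upwards [hl (e.open_baseSet.mem_nhds ht₀)] with t ht using norm_chart n E e ht _

theorem tendsto_smul_mk {t₀ : X} {l : Filter X} (hl : l ≤ 𝓝 t₀) {s : ∀ t, E t}
    {x : E t₀} (h : Tendsto (fun t => (⟨t, s t⟩ : TotalSpace (Mat n) E)) l (𝓝 ⟨t₀, x⟩))
    {g : X → ℂ} {c : ℂ} (hg : Tendsto g l (𝓝 c)) :
    Tendsto (fun t => (⟨t, g t • s t⟩ : TotalSpace (Mat n) E)) l (𝓝 ⟨t₀, c • x⟩) := by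
  let e := trivializationAt (Mat n) E t₀
  have ht₀ : t₀ ∈ e.baseSet := mem_baseSet_trivializationAt (Mat n) E t₀
  rw [tendsto_mk_iff e ht₀ hl, chart_smul e ht₀]
  refine (hg.smul ((tendsto_mk_iff e ht₀ hl).1 h)).congr' ?_
  filter_upwards [hl (e.open_baseSet.mem_nhds ht₀)] with t ht using (chart_smul e ht _ _).symm

theorem tendsto_zero_mk {t₀ : X} {l : Filter X} (hl : l ≤ 𝓝 t₀) {s : ∀ t, E t}
    (h : Tendsto (fun t => ‖s t‖) l (𝓝 0)) :
    Tendsto (fun t => (⟨t, s t⟩ : TotalSpace (Mat n) E)) l (𝓝 ⟨t₀, 0⟩) := by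
  let e := trivializationAt (Mat n) E t₀
  have ht₀ : t₀ ∈ e.baseSet := mem_baseSet_trivializationAt (Mat n) E t₀
  rw [tendsto_mk_iff e ht₀ hl, chart_zero e ht₀, tendsto_zero_iff_norm_tendsto_zero]
  refine h.congr' ?_
  filter_upwards [hl (e.open_baseSet.mem_nhds ht₀)] with t ht using (norm_chart n E e ht _).symm

theorem exists_norm_le_of_isCompact {K : Set X} (hK : IsCompact K) {s : ∀ t, E t}
    (hs : ContinuousOn (fun t => (⟨t, s t⟩ : TotalSpace (Mat n) E)) K) :
    ∃ M : ℝ, 0 ≤ M ∧ ∀ t ∈ K, ‖s t‖ ≤ M := by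
  have h : ContinuousOn (fun t => ‖s t‖) K := fun t ht =>
    tendsto_norm_of_tendsto_mk inf_le_left (hs t ht)
  obtain ⟨M, hM⟩ := hK.bddAbove_image h
  exact ⟨max M 0, le_max_right _ _, fun t ht => (hM ⟨t, ht, rfl⟩).trans (le_max_left _ _)⟩

/-- A continuous section over a compact set `K`, multiplied by a continuous function that vanishes
off `K`, extends by zero to an element of `Γ₀(E)`. -/
theorem exists_evalAt_eq_smul {K : Set X} (hK : IsCompact K) {s : ∀ t, E t}
    (hs : ContinuousOn (fun t => (⟨t, s t⟩ : TotalSpace (Mat n) E)) K) {g : X → ℝ}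
    (hg : Continuous g) (hgK : ∀ t ∉ K, g t = 0) :
    ∃ a : Gamma₀ n E, ∀ t, evalAt n E t a = (g t : ℂ) • s t := by
  obtain ⟨M, hM0, hM⟩ := exists_norm_le_of_isCompact hK hs
  have hle : ∀ t, ‖(g t : ℂ) • s t‖ ≤ |g t| * M := fun t => by
    rw [norm_smul, Complex.norm_real, Real.norm_eq_abs]
    by_cases ht : t ∈ K
    · gcongr
      exact hM t ht
    · simp [hgK t ht]
  obtain ⟨M', hM'⟩ := hK.bddAbove_image (f := fun t => |g t|) hg.abs.continuousOn
  have hmem : Memℓp (fun t => (g t : ℂ) • s t) ∞ := by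
    refine memℓp_infty ⟨max M' 0 * M, ?_⟩
    rintro _ ⟨t, rfl⟩
    refine (hle t).trans ?_
    gcongr
    by_cases ht : t ∈ K
    · exact (hM' ⟨t, ht, rfl⟩).trans (le_max_left _ _)
    · simp [hgK t ht]
  refine ⟨⟨⟨_, hmem⟩, ?_, ?_⟩, fun t => rfl⟩
  · change Continuous fun t => (⟨t, (g t : ℂ) • s t⟩ : TotalSpace (Mat n) E)
    rw [continuous_iff_continuousAt]
    intro t₀
    -- Where g vanishes, s need not be continuous, but it is bounded on K, so the product tends to
    -- 0. Where g does not vanish, K is a neighbourhood of the point.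
    by_cases h0 : g t₀ = 0
    · have h1 : Tendsto (fun t => |g t| * M) (𝓝 t₀) (𝓝 0) := by
        have := (hg.abs.mul continuous_const).tendsto (f := fun t => |g t| * M) t₀
        simpa [h0] using this
      have h2 := tendsto_zero_mk (n := n) le_rfl
        (squeeze_zero (fun t => norm_nonneg ((g t : ℂ) • s t)) hle h1)
      have h3 : (g t₀ : ℂ) • s t₀ = 0 := by rw [h0, Complex.ofReal_zero, zero_smul]
      rw [ContinuousAt, h3]
      exact h2
    · have hKt : K ∈ 𝓝 t₀ := by
        filter_upwards [hg.continuousAt.eventually_ne h0] with t ht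
        by_contra h
        exact ht (hgK t h)
      exact tendsto_smul_mk le_rfl ((hs t₀ (mem_of_mem_nhds hKt)).continuousAt hKt)
        (Complex.continuous_ofReal.comp hg).continuousAt
  · refine tendsto_const_nhds.congr' ?_
    filter_upwards [hK.compl_mem_cocompact] with t ht
    rw [hgK t ht, Complex.ofReal_zero, zero_smul, norm_zero]

theorem norm_le_of_forall_evalAt (a : Gamma₀ n E) {C : ℝ} (hC : 0 ≤ C)
    (h : ∀ t, ‖evalAt n E t a‖ ≤ C) : ‖a‖ ≤ C :=
  lp.norm_le_of_forall_le hC h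

theorem continuous_evalAt (a : Gamma₀ n E) :
    Continuous fun t => (⟨t, evalAt n E t a⟩ : TotalSpace (Mat n) E) := a.2.1

variable [T2Space X] [LocallyCompactSpace X]

/-- Every element of a fibre is the value of a section of no larger norm which is constant near the
given point in a given chart. -/
theorem exists_evalAt_eventually_eq (e : Trivialization (Mat n) (π (Mat n) E))
    [MemTrivializationAtlas e] {t₀ : X} (ht₀ : t₀ ∈ e.baseSet) (y : Mat n) :
    ∃ a : Gamma₀ n E, ‖a‖ ≤ ‖y‖ ∧ ∀ᶠ t in 𝓝 t₀, (e ⟨t, evalAt n E t a⟩).2 = y := by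
  obtain ⟨K, hK, hKt, hKe⟩ := exists_compact_subset e.open_baseSet ht₀
  -- Two nested compact neighbourhoods: the cutoff is 1 on the inner one, giving local constancy,
  -- and 0 off the outer one.
  obtain ⟨K', hK', hKt', hKe'⟩ := exists_compact_subset isOpen_interior hKt
  obtain ⟨f, hf1, hf0, -, hfI⟩ := exists_continuous_one_zero_of_isCompact hK'
    (isOpen_interior (s := K)).isClosed_compl (disjoint_compl_right_iff_subset.2 hKe')
  have hfK : ∀ t, t ∉ K → f t = 0 := fun t ht => hf0 fun h => ht (interior_subset h)
  have hs : ContinuousOn (fun t => (⟨t, e.symm t y⟩ : TotalSpace (Mat n) E)) K := fun t ht => by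
    refine (tendsto_mk_iff e (hKe ht) inf_le_left).2 ?_
    rw [chart_symm e (hKe ht)]
    refine tendsto_const_nhds.congr' ?_
    filter_upwards [self_mem_nhdsWithin] with u hu using (chart_symm e (hKe hu) y).symm
  obtain ⟨a, ha⟩ := exists_evalAt_eq_smul hK hs f.continuous hfK
  refine ⟨a, norm_le_of_forall_evalAt a (norm_nonneg y) fun t => ?_, ?_⟩
  · rw [ha]
    by_cases ht : t ∈ K
    · rw [norm_smul, ← norm_chart n E e (hKe ht), chart_symm e (hKe ht), Complex.norm_real,
        Real.norm_of_nonneg (hfI t).1]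
      exact mul_le_of_le_one_left (norm_nonneg _) (hfI t).2
    · rw [hfK t ht, Complex.ofReal_zero, zero_smul, norm_zero]
      exact norm_nonneg y
  · filter_upwards [mem_interior_iff_mem_nhds.1 hKt'] with t ht
    have h1 : f t = 1 := hf1 ht
    rw [ha, h1, Complex.ofReal_one, one_smul,
      chart_symm e (hKe (interior_subset (hKe' ht)))]

/-- The lift has no larger norm, so passing from φ to φ_t loses no constant in
`norm_fibreMap_sub_le`. -/
theorem exists_evalAt_eq_norm_le (n : ℕ) {E : X → Type*} [∀ t, CStarAlgebra (E t)]
    [TopologicalSpace (TotalSpace (Mat n) E)] [FiberBundle (Mat n) E] [VectorBundle ℂ (Mat n) E]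
    [IsMatrixBundle n E] {t : X} (x : E t) :
    ∃ a : Gamma₀ n E, ‖a‖ ≤ ‖x‖ ∧ evalAt n E t a = x := by
  have ht := mem_baseSet_trivializationAt (Mat n) E t
  obtain ⟨a, ha, h⟩ := exists_evalAt_eventually_eq _ ht (trivializationAt (Mat n) E t ⟨t, x⟩).2
  exact ⟨a, ha.trans_eq (norm_chart n E _ ht x), chart_injective _ ht h.self_of_nhds⟩

end Sections

/-! ### The family of fibre operators: norms and continuity. -/

section FibreMap

variable {X : Type*} [TopologicalSpace X] {n : ℕ} {E : X → Type*} [∀ t, CStarAlgebra (E t)]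
  [TopologicalSpace (TotalSpace (Mat n) E)] [FiberBundle (Mat n) E] [VectorBundle ℂ (Mat n) E]
  [IsMatrixBundle n E] {φ ψ : Gamma₀ n E →L[ℂ] Gamma₀ n E}

theorem TM₀_subset_IB : TM₀ n E ⊆ IB n E := by
  rintro φ ⟨a, b, h⟩ I - x hx
  rw [h]
  exact I.mul_mem_right _ _ (I.mul_mem_left _ _ hx)

theorem isClosed_IB : IsClosed (IB n E) := by
  simp only [IB, ofPred_forall]
  refine isClosed_iInter fun I => isClosed_iInter fun hI => isClosed_iInter fun a =>
    isClosed_iInter fun _ => ?_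
  exact hI.preimage (ContinuousLinearMap.apply ℂ (Gamma₀ n E) a).continuous

variable [T2Space X] [LocallyCompactSpace X]

theorem norm_fibreMap_sub_le (hφ : φ ∈ IB n E) (hψ : ψ ∈ IB n E) (t : X) :
    ‖fibreMap φ hφ t - fibreMap ψ hψ t‖ ≤ ‖φ - ψ‖ := by
  refine ContinuousLinearMap.opNorm_le_bound _ (ContinuousLinearMap.opNorm_nonneg _) fun x => ?_
  obtain ⟨a, ha, rfl⟩ := exists_evalAt_eq_norm_le n x
  have h : (fibreMap φ hφ t - fibreMap ψ hψ t) (evalAt n E t a) =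
      evalAt n E t ((φ - ψ) a) := by
    change fibreMap φ hφ t _ - fibreMap ψ hψ t _ = evalAt n E t (φ a - ψ a)
    rw [fibreMap_evalAt, fibreMap_evalAt, map_sub]
  rw [h]
  exact (norm_evalAt_le n E t _).trans
    (((φ - ψ).le_opNorm a).trans (mul_le_mul_of_nonneg_left ha
      (ContinuousLinearMap.opNorm_nonneg _)))

theorem norm_sub_le_of_fibreMap (hφ : φ ∈ IB n E) (hψ : ψ ∈ IB n E) {C : ℝ} (hC : 0 ≤ C)
    (h : ∀ t, ‖fibreMap φ hφ t - fibreMap ψ hψ t‖ ≤ C) : ‖φ - ψ‖ ≤ C := by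
  refine ContinuousLinearMap.opNorm_le_bound _ hC fun a =>
    norm_le_of_forall_evalAt _ (by positivity) fun t => ?_
  have h1 : evalAt n E t ((φ - ψ) a) =
      (fibreMap φ hφ t - fibreMap ψ hψ t) (evalAt n E t a) := by
    change evalAt n E t (φ a - ψ a) = fibreMap φ hφ t _ - fibreMap ψ hψ t _
    rw [fibreMap_evalAt, fibreMap_evalAt, map_sub]
  rw [h1]
  exact (ContinuousLinearMap.le_opNorm _ _).trans
    (mul_le_mul (h t) (norm_evalAt_le n E t a) (norm_nonneg _) hC)

theorem fibreMap_of_mul (hψ : ψ ∈ IB n E) {a b : Gamma₀ n E} (h : ∀ x, ψ x = a * x * b) (t : X)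
    (x : E t) : fibreMap ψ hψ t x = evalAt n E t a * x * evalAt n E t b := by
  obtain ⟨y, rfl⟩ := evalAt_surjective n E t x
  rw [fibreMap_evalAt, h]
  rfl

theorem norm_fibreMap_of_mul_le (hψ : ψ ∈ IB n E) {a b : Gamma₀ n E} (h : ∀ x, ψ x = a * x * b)
    (t : X) : ‖fibreMap ψ hψ t‖ ≤ ‖evalAt n E t a‖ * ‖evalAt n E t b‖ := by
  refine ContinuousLinearMap.opNorm_le_bound _ (by positivity) fun x => ?_
  rw [fibreMap_of_mul hψ h]
  calc _ ≤ ‖evalAt n E t a‖ * ‖x‖ * ‖evalAt n E t b‖ :=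
        (norm_mul_le _ _).trans (by gcongr; exact norm_mul_le _ _)
    _ = _ := by ring

/-- As M_n is finite-dimensional, pointwise continuity suffices. A vector y is realised near a point
by a section a constant in the chart, and then the values in question are those of the continuous
section φ(a). -/
theorem continuousOn_chartOp_fibreMap (hφ : φ ∈ IB n E)
    (e : Trivialization (Mat n) (π (Mat n) E)) [MemTrivializationAtlas e] :
    ContinuousOn (fun t => chartOp e t (fibreMap φ hφ t)) e.baseSet := by
  rw [continuousOn_clm_apply]
  intro y t₀ ht₀
  refine ContinuousAt.continuousWithinAt ?_
  obtain ⟨a, -, ha⟩ := exists_evalAt_eventually_eq e ht₀ y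
  have h1 := (tendsto_mk_iff e ht₀ le_rfl).1 ((continuous_evalAt (φ a)).continuousAt (x := t₀))
  have h2 : ∀ᶠ t in 𝓝 t₀, (e ⟨t, evalAt n E t (φ a)⟩).2 = chartOp e t (fibreMap φ hφ t) y := by
    filter_upwards [ha, e.open_baseSet.mem_nhds ht₀] with t hta ht
    rw [← hta, chartOp_chart e ht, fibreMap_evalAt]
  rw [ContinuousAt, ← h2.self_of_nhds]
  exact h1.congr' h2

theorem tendsto_chartOp_fibreMap (hφ : φ ∈ IB n E)
    (e : Trivialization (Mat n) (π (Mat n) E)) [MemTrivializationAtlas e] {t₀ : X}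
    (ht₀ : t₀ ∈ e.baseSet) {l : Filter X} (hl : l ≤ 𝓝 t₀) :
    Tendsto (fun t => chartOp e t (fibreMap φ hφ t)) l
      (𝓝 (chartOp e t₀ (fibreMap φ hφ t₀))) :=
  ((continuousOn_chartOp_fibreMap hφ e).continuousAt (e.open_baseSet.mem_nhds ht₀)).mono_left hl

theorem continuous_norm_fibreMap (hφ : φ ∈ IB n E) : Continuous fun t => ‖fibreMap φ hφ t‖ := by
  rw [continuous_iff_continuousAt]
  intro t₀
  let e := trivializationAt (Mat n) E t₀
  have ht₀ : t₀ ∈ e.baseSet := mem_baseSet_trivializationAt (Mat n) E t₀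
  have hn : Continuous fun T : Mat n →L[ℂ] Mat n => ‖T‖ :=
    continuous_norm (E := Mat n →L[ℂ] Mat n)
  have h := (hn.tendsto _).comp (tendsto_chartOp_fibreMap hφ e ht₀ le_rfl)
  rw [norm_chartOp e ht₀] at h
  refine h.congr' ?_
  filter_upwards [e.open_baseSet.mem_nhds ht₀] with t ht using norm_chartOp e ht _

theorem lineBundle_eq_span (hφ : φ ∈ IB n E) {t : X} (ht : t ∈ coz φ hφ) {a b : E t}
    (h : ∀ x, fibreMap φ hφ t x = a * x * b) :
    lineBundle φ hφ t = Submodule.span ℂ {a} := by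
  refine le_antisymm (Submodule.span_le.2 ?_)
    (Submodule.span_mono (singleton_subset_iff.2 ⟨b, h⟩))
  rintro a' ⟨b', h'⟩
  obtain ⟨r, rfl⟩ := exists_smul_eq_of_fibre_mul_eq n ht h h'
  exact Submodule.smul_mem _ _ (Submodule.mem_span_singleton_self a)

end FibreMap

/-! ### Trivial line families and nowhere vanishing sections. -/

section Triviality

variable {X : Type*} [TopologicalSpace X] {n : ℕ} {E : X → Type*} [∀ t, CStarAlgebra (E t)]
  [TopologicalSpace (TotalSpace (Mat n) E)] [FiberBundle (Mat n) E] [VectorBundle ℂ (Mat n) E]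
  [IsMatrixBundle n E]

/-- A family of lines spanned by the values of a continuous nowhere vanishing section over `K` is
trivial over `K`. -/
theorem isTrivialOn_of_section [NeZero n] {L : ∀ t, Submodule ℂ (E t)} {K : Set X} {s : ∀ t, E t}
    (hs : ContinuousOn (fun t => (⟨t, s t⟩ : TotalSpace (Mat n) E)) K)
    (hs0 : ∀ t ∈ K, s t ≠ 0) (hL : ∀ t ∈ K, L t = Submodule.span ℂ {s t}) :
    IsTrivialOn n L K := by
  -- The coefficient of the Hilbert-Schmidt projection onto the line of s(t); it is continuous in
  -- charts and fibrewise linear.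
  let coord : ∀ t, E t → ℂ := fun t x =>
    (fibreTrace n t (star (s t) * s t))⁻¹ * fibreTrace n t (star (s t) * x)
  have hcoord : ∀ t ∈ K, ∀ z : ℂ, coord t (z • s t) = z := fun t ht z => by
    have h := fibreTrace_star_mul_self_ne_zero (n := n) (hs0 t ht)
    simp only [coord, mul_smul_comm, map_smul, smul_eq_mul]
    field_simp
  refine ⟨
    { toFun := fun p => (⟨p.1.proj, p.2.1⟩, coord p.1.proj p.1.snd)
      invFun := fun q => ⟨⟨q.1, q.2 • s q.1⟩, q.1.2, by
        change q.2 • s q.1 ∈ L q.1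
        rw [hL _ q.1.2]
        exact Submodule.smul_mem _ _ (Submodule.mem_span_singleton_self _)⟩
      left_inv := ?_
      right_inv := ?_
      continuous_toFun := ?_
      continuous_invFun := ?_ }, fun p => rfl, fun t ht => ⟨fun ξ η => ?_, fun c ξ => ?_⟩⟩
  · rintro ⟨⟨t, x⟩, ht, hx⟩
    refine Subtype.ext ?_
    change (⟨t, coord t x • s t⟩ : TotalSpace (Mat n) E) = ⟨t, x⟩
    change x ∈ L t at hx
    rw [hL t ht, Submodule.mem_span_singleton] at hx
    obtain ⟨z, rfl⟩ := hx
    rw [hcoord t ht]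
  · rintro ⟨⟨t, ht⟩, z⟩
    exact Prod.ext rfl (hcoord t ht z)
  · have hproj : Continuous fun p : {p : TotalSpace (Mat n) E // p.proj ∈ K ∧ p.snd ∈ L p.proj} =>
        p.1.proj := (FiberBundle.continuous_proj (Mat n) E).comp continuous_subtype_val
    refine (hproj.subtype_mk fun p => p.2.1).prodMk (continuous_iff_continuousAt.2 fun p₀ => ?_)
    let e := trivializationAt (Mat n) E p₀.1.proj
    have ht₀ : p₀.1.proj ∈ e.baseSet := mem_baseSet_trivializationAt (Mat n) E _
    have h1 : ContinuousAt
        (fun p : {p : TotalSpace (Mat n) E // p.proj ∈ K ∧ p.snd ∈ L p.proj} => (e p.1).2) p₀ :=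
      continuousAt_snd.comp <| ContinuousAt.comp (f := Subtype.val)
        (e.continuousAt (e.mem_source.2 ht₀)) continuous_subtype_val.continuousAt
    have h2 : ContinuousAt
        (fun p : {p : TotalSpace (Mat n) E // p.proj ∈ K ∧ p.snd ∈ L p.proj} =>
          (e ⟨p.1.proj, s p.1.proj⟩).2) p₀ :=
      Tendsto.comp (g := fun t => (e ⟨t, s t⟩).2)
        ((tendsto_mk_iff e ht₀ inf_le_left).1 (hs _ p₀.2.1))
        (tendsto_nhdsWithin_iff.2 ⟨hproj.continuousAt, Eventually.of_forall fun p => p.2.1⟩)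
    have h3 : ∀ t (ht : t ∈ e.baseSet) (x : E t), coord t x =
        (matTrace (star (e ⟨t, s t⟩).2 * (e ⟨t, s t⟩).2))⁻¹ *
          matTrace (star (e ⟨t, s t⟩).2 * (e ⟨t, x⟩).2) := fun t ht x => by
      simp only [coord, fibreTrace_eq e ht, IsMatrixBundle.map_mul e t ht,
        IsMatrixBundle.map_star e t ht]
    have h4 : ContinuousAt
        (fun p : {p : TotalSpace (Mat n) E // p.proj ∈ K ∧ p.snd ∈ L p.proj} =>
          (matTrace (star (e ⟨p.1.proj, s p.1.proj⟩).2 * (e ⟨p.1.proj, s p.1.proj⟩).2))⁻¹ *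
          matTrace (star (e ⟨p.1.proj, s p.1.proj⟩).2 * (e p.1).2)) p₀ := by
      refine ContinuousAt.mul (ContinuousAt.inv₀ ?_ ?_) ?_
      · exact ContinuousAt.comp (f := fun p : {p : TotalSpace (Mat n) E //
          p.proj ∈ K ∧ p.snd ∈ L p.proj} =>
          star (e ⟨p.1.proj, s p.1.proj⟩).2 * (e ⟨p.1.proj, s p.1.proj⟩).2)
          continuous_matTrace.continuousAt (h2.star.mul h2)
      · have := fibreTrace_star_mul_self_ne_zero (n := n) (hs0 _ p₀.2.1)
        rwa [fibreTrace_eq e ht₀, IsMatrixBundle.map_mul e _ ht₀,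
          IsMatrixBundle.map_star e _ ht₀] at this
      · exact ContinuousAt.comp (f := fun p : {p : TotalSpace (Mat n) E //
          p.proj ∈ K ∧ p.snd ∈ L p.proj} => star (e ⟨p.1.proj, s p.1.proj⟩).2 * (e p.1).2)
          continuous_matTrace.continuousAt (h2.star.mul h1)
    refine h4.congr ?_
    filter_upwards [hproj.continuousAt (e.open_baseSet.mem_nhds ht₀)] with p hp
    exact (h3 p.1.proj hp p.1.snd).symm
  · refine Continuous.subtype_mk (continuous_iff_continuousAt.2 fun q₀ => ?_) _
    let e := trivializationAt (Mat n) E (q₀.1 : X)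
    have ht₀ : (q₀.1 : X) ∈ e.baseSet := mem_baseSet_trivializationAt (Mat n) E _
    have hproj : ContinuousAt (fun q : K × ℂ => (q.1 : X)) q₀ :=
      (continuous_subtype_val.comp continuous_fst).continuousAt
    have h : ContinuousAt (fun q : K × ℂ => (⟨q.1, q.2 • s q.1⟩ : TotalSpace (Mat n) E)) q₀ ↔ _ :=
      e.tendsto_nhds_iff (e.mem_source.2 ht₀)
    refine h.2 ⟨hproj, ?_⟩
    have h2 : ContinuousAt (fun q : K × ℂ => (e ⟨q.1, s q.1⟩).2) q₀ :=
      Tendsto.comp (g := fun t => (e ⟨t, s t⟩).2)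
        ((tendsto_mk_iff e ht₀ inf_le_left).1 (hs _ q₀.1.2))
        (tendsto_nhdsWithin_iff.2 ⟨hproj, Eventually.of_forall fun q => q.1.2⟩)
    have h3 : Tendsto (fun q : K × ℂ => q.2 • (e ⟨q.1, s q.1⟩).2) (𝓝 q₀)
        (𝓝 (e ⟨q₀.1, q₀.2 • s q₀.1⟩).2) := by
      rw [chart_smul e ht₀]
      exact continuousAt_snd.smul h2
    refine h3.congr' ?_
    filter_upwards [hproj (e.open_baseSet.mem_nhds ht₀)] with q hq
    exact (chart_smul e hq _ _).symm
  · change coord t ((ξ : E t) + η) = coord t ξ + coord t η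
    simp only [coord, mul_add, map_add]
  · change coord t (c • (ξ : E t)) = c * coord t ξ
    simp only [coord, mul_smul_comm, map_smul, smul_eq_mul]
    ring

/-- A trivial family of subspaces has a continuous nowhere vanishing section. -/
theorem IsTrivialOn.exists_section {L : ∀ t, Submodule ℂ (E t)} {K : Set X}
    (h : IsTrivialOn n L K) : ∃ s : ∀ t, E t,
      ContinuousOn (fun t => (⟨t, s t⟩ : TotalSpace (Mat n) E)) K ∧
        ∀ t ∈ K, s t ≠ 0 ∧ s t ∈ L t := by
  obtain ⟨h, hproj, hlin⟩ := h
  have key : ∀ t, ∃ x : E t, ∀ ht : t ∈ K,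
      (x ≠ 0 ∧ x ∈ L t) ∧ (h.symm (⟨t, ht⟩, 1)).1 = ⟨t, x⟩ := by
    intro t
    by_cases ht : t ∈ K
    · suffices ∃ x : E t, (x ≠ 0 ∧ x ∈ L t) ∧ (h.symm (⟨t, ht⟩, 1)).1 = ⟨t, x⟩ from
        this.imp fun x hx _ => hx
      have h1 := hproj (h.symm (⟨t, ht⟩, 1))
      have h2 : (h (h.symm (⟨t, ht⟩, 1))).2 = 1 := by rw [h.apply_symm_apply]
      rw [h.apply_symm_apply] at h1
      -- The point p lies over t only propositionally; generalizing it allows its base point to be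
      -- replaced by t.
      generalize h.symm (⟨t, ht⟩, 1) = p at h1 h2 ⊢
      obtain ⟨⟨t', x⟩, ht', hx⟩ := p
      change t = t' at h1
      subst h1
      refine ⟨x, ⟨?_, hx⟩, rfl⟩
      rintro rfl
      have h3 := (hlin t ht).map_zero
      exact one_ne_zero (h2.symm.trans h3)
    · exact ⟨0, fun h => absurd h ht⟩
  choose s hs using key
  refine ⟨s, ?_, fun t ht => (hs t ht).1⟩
  rw [continuousOn_iff_continuous_domRestrict]
  have : Continuous fun t : K => (h.symm (t, 1)).1 :=
    continuous_subtype_val.comp (h.symm.continuous.comp (continuous_id.prodMk continuous_const))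
  refine this.congr fun t => (hs t t.2).2

end Triviality

/-! ### The two implications. -/

section Closure

variable {X : Type*} [TopologicalSpace X] {n : ℕ} {E : X → Type*} [∀ t, CStarAlgebra (E t)]
  [TopologicalSpace (TotalSpace (Mat n) E)] [FiberBundle (Mat n) E] [VectorBundle ℂ (Mat n) E]
  [IsMatrixBundle n E] [T2Space X] [LocallyCompactSpace X] {φ : Gamma₀ n E →L[ℂ] Gamma₀ n E}

theorem exists_mul_norm_sub_lt (h : φ ∈ closure (TM₀ n E)) {ε : ℝ} (hε : 0 < ε) :
    ∃ (ψ : Gamma₀ n E →L[ℂ] Gamma₀ n E) (a b : Gamma₀ n E),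
      (∀ x, ψ x = a * x * b) ∧ ψ ∈ IB n E ∧ ‖φ - ψ‖ < ε := by
  obtain ⟨ψ, ⟨a, b, hab⟩, hd⟩ :=
    (Metric.mem_closure_iff (α := Gamma₀ n E →L[ℂ] Gamma₀ n E)).1 h ε hε
  exact ⟨ψ, a, b, hab, TM₀_subset_IB ⟨a, b, hab⟩,
    (dist_eq_norm (E := Gamma₀ n E →L[ℂ] Gamma₀ n E) φ ψ).symm.trans_lt hd⟩

theorem mem_IB₁_of_mem_closure (h : φ ∈ closure (TM₀ n E)) (hφ : φ ∈ IB n E) : φ ∈ IB₁ n E := by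
  refine ⟨hφ, fun t => ?_⟩
  have ht := mem_baseSet_trivializationAt (Mat n) E t
  refine exists_mul_of_chartOp _ ht ?_
  have hc : chartOp (trivializationAt (Mat n) E t) t (fibreMap φ hφ t) ∈
      closure {T : Mat n →L[ℂ] Mat n | ∃ a b, ∀ x, T x = a * x * b} := by
    refine (Metric.mem_closure_iff (α := Mat n →L[ℂ] Mat n)).2 fun ε hε => ?_
    obtain ⟨ψ, a, b, hab, hψ, hd⟩ := exists_mul_norm_sub_lt h hε
    refine ⟨chartOp (trivializationAt (Mat n) E t) t (fibreMap ψ hψ t),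
      ⟨_, _, chartOp_mul _ ht (fibreMap_of_mul hψ hab t)⟩, ?_⟩
    refine (dist_eq_norm (E := Mat n →L[ℂ] Mat n) _ _).trans_lt ?_
    rw [← chartOp_sub, norm_chartOp _ ht]
    exact (norm_fibreMap_sub_le hφ hψ t).trans_lt hd
  exact (isClosed_setOf_mul n).closure_subset hc

/-- Continuity of the norm function holds on all of IB(A); only the decay at infinity uses
approximation, through ‖ψ_t‖ ≤ ‖a(t)‖ ‖b‖. -/
theorem mem_IB₀_of_mem_closure (h : φ ∈ closure (TM₀ n E)) (hφ : φ ∈ IB n E) : φ ∈ IB₀ n E := by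
  refine ⟨hφ, ⟨⟨fun t => ‖fibreMap φ hφ t‖, continuous_norm_fibreMap hφ⟩, ?_⟩, fun t => rfl⟩
  rw [Metric.tendsto_nhds]
  intro ε hε
  obtain ⟨ψ, a, b, hab, hψ, hd⟩ := exists_mul_norm_sub_lt h (half_pos hε)
  have h1 : Tendsto (fun t => ‖evalAt n E t a‖ * ‖b‖) (cocompact X) (𝓝 0) := by
    have := a.2.2.mul_const ‖b‖
    rw [zero_mul] at this
    exact this
  filter_upwards [h1.eventually_lt_const (half_pos hε)] with t ht
  rw [Real.dist_0_eq_abs, abs_of_nonneg (ContinuousLinearMap.opNorm_nonneg _)]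
  have h2 := norm_fibreMap_sub_le hφ hψ t
  have h3 := norm_sub_norm_le (fibreMap φ hφ t) (fibreMap ψ hψ t)
  have h4 := norm_fibreMap_of_mul_le hψ hab t
  have h5 : ‖evalAt n E t a‖ * ‖evalAt n E t b‖ ≤ ‖evalAt n E t a‖ * ‖b‖ :=
    mul_le_mul_of_nonneg_left (norm_evalAt_le n E t b) (norm_nonneg _)
  linarith

/-- If two two-sided multiplications on `M_n` are close, relative to the norms of the coefficients,
then so are the right coefficients, in the sense that they are not orthogonal. -/
theorem exists_matTrace_mul_star_ne_zero (n : ℕ) : ∃ C : ℝ, 0 < C ∧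
    ∀ (S T : Mat n →L[ℂ] Mat n) (a b a' b' : Mat n), (∀ x, T x = a * x * b) →
      (∀ x, S x = a' * x * b') → C * ‖T - S‖ < ‖a'‖ * ‖b'‖ → matTrace (b * star b') ≠ 0 := by
  obtain ⟨C, hC, hC'⟩ := exists_norm_leftCoeff_le n
  obtain ⟨D, hD, hD'⟩ := exists_sq_norm_le_matTrace n
  refine ⟨D * C, by positivity, fun S T a b a' b' hT hS hlt h0 => ?_⟩
  have hb' : 0 < ‖b'‖ := by
    refine (norm_nonneg b').lt_of_ne fun h => ?_
    rw [← h, mul_zero] at hlt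
    exact hlt.not_ge (mul_nonneg (by positivity) (ContinuousLinearMap.opNorm_nonneg _))
  -- If b were orthogonal to b', only the contribution of S would survive. Its size is at least
  -- ‖b'‖² ‖a'‖ / D, against the upper bound C ‖T - S‖ ‖b'‖.
  have h1 : leftCoeff (T - S) (star b') = -(matTrace (b' * star b') • a') := by
    rw [leftCoeff_sub, leftCoeff_eq hT, leftCoeff_eq hS, h0, zero_smul, zero_sub]
  have h2 := hC' (T - S) (star b')
  have hstar : ‖star b'‖ = ‖b'‖ := norm_star b'
  rw [h1, norm_neg, norm_smul, hstar, matTrace_mul_comm] at h2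
  have h3 := hD' b'
  refine hlt.not_ge (le_of_mul_le_mul_right ?_ hb')
  calc ‖a'‖ * ‖b'‖ * ‖b'‖ = ‖b'‖ ^ 2 * ‖a'‖ := by ring
    _ ≤ D * ‖matTrace (star b' * b')‖ * ‖a'‖ := by gcongr
    _ = D * (‖matTrace (star b' * b')‖ * ‖a'‖) := by ring
    _ ≤ D * (C * ‖T - S‖ * ‖b'‖) := by gcongr
    _ = _ := by ring

theorem isTrivialOn_of_mem_closure [NeZero n] (h : φ ∈ closure (TM₀ n E)) (hφ : φ ∈ IB n E)
    {K : Set X} (hK : IsCompact K) (hKφ : K ⊆ coz φ hφ) :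
    IsTrivialOn n (lineBundle φ hφ) K := by
  obtain ⟨δ, hδ, hKδ⟩ : ∃ δ : ℝ, 0 < δ ∧ ∀ t ∈ K, δ ≤ ‖fibreMap φ hφ t‖ :=
    hK.exists_forall_le' (continuous_norm_fibreMap hφ).continuousOn fun t ht => by
      have := finiteDimensional_fibre n E t
      exact norm_pos_iff.2 (hKφ ht)
  obtain ⟨C, hC, hC'⟩ := exists_matTrace_mul_star_ne_zero n
  -- With η = ‖φ_t - ψ_t‖ < δ / (C + 1) one gets ‖a'(t)‖ ‖b'(t)‖ ≥ ‖ψ_t‖ ≥ δ - η > C η, as `hC'`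
  -- requires.
  obtain ⟨ψ, a', b', hab', hψ, hd⟩ := exists_mul_norm_sub_lt h (ε := δ / (C + 1)) (by positivity)
  obtain ⟨_, hmul⟩ := mem_IB₁_of_mem_closure h hφ
  choose a b hab using hmul
  have hab : ∀ t x, fibreMap φ hφ t x = a t * x * b t := hab
  -- The chosen a and b need not be continuous, but s is: in a chart it is the left coefficient of
  -- φ_t at b'(t)*, by `hchart`.
  let s : ∀ t, E t := fun t => fibreTrace n t (b t * star (evalAt n E t b')) • a t
  have hne : ∀ t ∈ K, fibreTrace n t (b t * star (evalAt n E t b')) ≠ 0 := fun t ht => by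
    have ht' := mem_baseSet_trivializationAt (Mat n) E t
    rw [fibreTrace_eq _ ht', IsMatrixBundle.map_mul _ t ht', IsMatrixBundle.map_star _ t ht']
    refine hC' _ _ _ _ _ _ (chartOp_mul _ ht' (hab t))
      (chartOp_mul _ ht' (fibreMap_of_mul hψ hab' t)) ?_
    rw [← chartOp_sub, norm_chartOp _ ht', norm_chart n E _ ht', norm_chart n E _ ht']
    have h1 := norm_fibreMap_sub_le hφ hψ t
    have h2 := norm_sub_norm_le (fibreMap φ hφ t) (fibreMap ψ hψ t)
    have h3 := norm_fibreMap_of_mul_le hψ hab' t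
    have h4 := hKδ t ht
    have h5 : ‖fibreMap φ hφ t - fibreMap ψ hψ t‖ * (C + 1) < δ :=
      (lt_div_iff₀ (by positivity)).1 (h1.trans_lt hd)
    linarith
  have hchart : ∀ (e : Trivialization (Mat n) (π (Mat n) E)) [MemTrivializationAtlas e],
      ∀ t ∈ e.baseSet, (e ⟨t, s t⟩).2 =
        leftCoeff (chartOp e t (fibreMap φ hφ t)) (star (e ⟨t, evalAt n E t b'⟩).2) := by
    intro e _ t ht
    rw [leftCoeff_eq (chartOp_mul e ht (hab t)), chart_smul e ht, fibreTrace_eq e ht,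
      IsMatrixBundle.map_mul e t ht, IsMatrixBundle.map_star e t ht]
  refine isTrivialOn_of_section (s := s) ?_ (fun t ht => ?_) fun t ht => ?_
  · refine (continuous_iff_continuousAt.2 fun t₀ => ?_).continuousOn
    let e := trivializationAt (Mat n) E t₀
    have ht₀ : t₀ ∈ e.baseSet := mem_baseSet_trivializationAt (Mat n) E t₀
    refine (tendsto_mk_iff e ht₀ le_rfl).2 ?_
    rw [hchart e t₀ ht₀]
    refine (tendsto_leftCoeff (tendsto_chartOp_fibreMap hφ e ht₀ le_rfl)
      ((tendsto_mk_iff e ht₀ le_rfl).1 ((continuous_evalAt b').continuousAt)).star).congr' ?_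
    filter_upwards [e.open_baseSet.mem_nhds ht₀] with t ht using (hchart e t ht).symm
  · refine smul_ne_zero (hne t ht) fun h0 => hKφ ht (ContinuousLinearMap.ext fun x => ?_)
    rw [hab, h0, zero_mul, zero_mul]
    rfl
  · rw [lineBundle_eq_span hφ (hKφ ht) (hab t)]
    exact (Submodule.span_singleton_smul_eq (IsUnit.mk0 _ (hne t ht)) _).symm

/-- The right coefficient is continuous if the left one is so and does not vanish. -/
theorem continuousOn_right_of_left (hφ : φ ∈ IB n E) {K : Set X} {s b : ∀ t, E t}
    (hs : ContinuousOn (fun t => (⟨t, s t⟩ : TotalSpace (Mat n) E)) K)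
    (hs0 : ∀ t ∈ K, s t ≠ 0) (hb : ∀ t ∈ K, ∀ x, fibreMap φ hφ t x = s t * x * b t) :
    ContinuousOn (fun t => (⟨t, b t⟩ : TotalSpace (Mat n) E)) K := by
  intro t₀ htK
  let e := trivializationAt (Mat n) E t₀
  have ht₀ : t₀ ∈ e.baseSet := mem_baseSet_trivializationAt (Mat n) E t₀
  have hne : ∀ t ∈ K, t ∈ e.baseSet → matTrace (star (e ⟨t, s t⟩).2 * (e ⟨t, s t⟩).2) ≠ 0 :=
    fun t ht hte => mt matTrace_star_mul_self_eq_zero.1 fun h =>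
      hs0 t ht (chart_injective e hte (by rw [h, chart_zero e hte]))
  -- The right coefficient of φ_t at s(t)* is tr(s(t)* s(t)) b(t), and the scalar is invertible and
  -- continuous on K.
  have hchart : ∀ t ∈ K, t ∈ e.baseSet → (e ⟨t, b t⟩).2 =
      (matTrace (star (e ⟨t, s t⟩).2 * (e ⟨t, s t⟩).2))⁻¹ •
        rightCoeff (chartOp e t (fibreMap φ hφ t)) (star (e ⟨t, s t⟩).2) := by
    intro t ht hte
    rw [rightCoeff_eq (chartOp_mul e hte (hb t ht)), smul_smul, inv_mul_cancel₀ (hne t ht hte),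
      one_smul]
  have h1 := (tendsto_mk_iff e ht₀ inf_le_left).1 (hs t₀ htK)
  refine (tendsto_mk_iff e ht₀ inf_le_left).2 ?_
  rw [hchart t₀ htK ht₀]
  have h2 := (continuous_matTrace.tendsto _).comp (h1.star.mul h1)
  refine ((h2.inv₀ (hne t₀ htK ht₀)).smul (tendsto_rightCoeff
    (tendsto_chartOp_fibreMap hφ e ht₀ inf_le_left) h1.star)).congr' ?_
  filter_upwards [self_mem_nhdsWithin, mem_nhdsWithin_of_mem_nhds (e.open_baseSet.mem_nhds ht₀)]
    with t ht hte using (hchart t ht hte).symm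

theorem mem_closure_of_isTrivialOn (hφ : φ ∈ IB n E) (h : φ ∈ IB₀₁ n E)
    (hK : ∀ K : Set X, IsCompact K → K ⊆ coz φ hφ → IsTrivialOn n (lineBundle φ hφ) K) :
    φ ∈ closure (TM₀ n E) := by
  obtain ⟨⟨_, f, hf⟩, _, hmul⟩ := h
  have hf : ∀ t, f t = ‖fibreMap φ hφ t‖ := hf
  have hmul : ∀ t, ∃ a b : E t, ∀ x, fibreMap φ hφ t x = a * x * b := hmul
  refine (Metric.mem_closure_iff (α := Gamma₀ n E →L[ℂ] Gamma₀ n E)).2 fun ε' hε' => ?_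
  -- The final estimate is only ≤ ε, while the closure criterion asks for a strict inequality.
  obtain ⟨ε, hε, hεε'⟩ := exists_between hε'
  let K : Set X := {t | ε ≤ f t}
  have hKc : IsCompact K := by
    obtain ⟨K', hK', hKK'⟩ := mem_cocompact.1
      (f.zero_at_infty'.eventually_lt_const hε)
    refine hK'.of_isClosed_subset (isClosed_le continuous_const f.continuous) fun t ht => ?_
    by_contra hn
    have h1 : f t < ε := hKK' hn
    exact h1.not_ge ht
  have hKφ : K ⊆ coz φ hφ := fun t ht h0 => by
    have h1 : ε ≤ f t := ht
    rw [hf, h0] at h1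
    exact hε.not_ge (h1.trans_eq ContinuousLinearMap.opNorm_zero)
  obtain ⟨s, hs, hsK⟩ := (hK K hKc hKφ).exists_section
  have hb : ∀ t, ∃ b : E t, t ∈ K → ∀ x, fibreMap φ hφ t x = s t * x * b := by
    intro t
    by_cases ht : t ∈ K
    · obtain ⟨a₀, b₀, h₀⟩ := hmul t
      obtain ⟨hs0, hsL⟩ := hsK t ht
      rw [lineBundle_eq_span hφ (hKφ ht) h₀, Submodule.mem_span_singleton] at hsL
      obtain ⟨r, hr⟩ := hsL
      have hr0 : r ≠ 0 := by
        rintro rfl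
        exact hs0 (by rw [← hr, zero_smul])
      refine ⟨r⁻¹ • b₀, fun _ x => ?_⟩
      rw [h₀, ← hr, mul_smul_comm, smul_mul_assoc, smul_mul_assoc, smul_smul, inv_mul_cancel₀ hr0,
        one_smul]
    · exact ⟨0, fun h => absurd h ht⟩
  choose b hb using hb
  have hbc := continuousOn_right_of_left hφ hs (fun t ht => (hsK t ht).1) hb
  -- The square root because g multiplies both coefficients: ψ_t = g(t)² φ_t, so φ_t - ψ_t = (ε /
  -- max(f(t), ε)) φ_t has norm at most ε. The maximum makes g continuous everywhere and zero off K.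
  let g : X → ℝ := fun t => √(1 - ε / max (f t) ε)
  have hmax : ∀ t, 0 < max (f t) ε := fun t => lt_max_of_lt_right hε
  have hg : Continuous g := by
    have : Continuous fun t => max (f t) ε := f.continuous.max continuous_const
    exact (continuous_const.sub (continuous_const.div this fun t => (hmax t).ne')).sqrt
  have hgK : ∀ t ∉ K, g t = 0 := fun t ht => by
    have h1 : f t ≤ ε := (not_le.1 ht).le
    simp only [g, max_eq_right h1, div_self hε.ne', sub_self, Real.sqrt_zero]
  have hg2 : ∀ t, g t * g t = 1 - ε / max (f t) ε := fun t => by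
    refine Real.mul_self_sqrt (sub_nonneg.2 ((div_le_one (hmax t)).2 (le_max_right _ _)))
  obtain ⟨a', ha'⟩ := exists_evalAt_eq_smul hKc hs hg hgK
  obtain ⟨b', hb'⟩ := exists_evalAt_eq_smul hKc hbc hg hgK
  let ψ : Gamma₀ n E →L[ℂ] Gamma₀ n E :=
    (ContinuousLinearMap.mul ℂ (Gamma₀ n E)).flip b' ∘L ContinuousLinearMap.mul ℂ (Gamma₀ n E) a'
  have hψ : ∀ x, ψ x = a' * x * b' := fun x => rfl
  have hψTM : ψ ∈ TM₀ n E := ⟨a', b', hψ⟩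
  have hψIB := TM₀_subset_IB hψTM
  refine ⟨ψ, hψTM, ?_⟩
  refine (dist_eq_norm (E := Gamma₀ n E →L[ℂ] Gamma₀ n E) φ ψ).trans_lt ?_
  refine (norm_sub_le_of_fibreMap hφ hψIB hε.le fun t => ?_).trans_lt hεε'
  have h1 : ∀ x, (fibreMap φ hφ t - fibreMap ψ hψIB t) x =
      ((ε / max (f t) ε : ℝ) : ℂ) • fibreMap φ hφ t x := by
    intro x
    change fibreMap φ hφ t x - fibreMap ψ hψIB t x = _
    have h2 : fibreMap ψ hψIB t x = ((1 - ε / max (f t) ε : ℝ) : ℂ) • fibreMap φ hφ t x := by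
      rw [fibreMap_of_mul hψIB hψ, ha', hb', ← hg2]
      by_cases ht : t ∈ K
      · rw [hb t ht, smul_mul_assoc, smul_mul_assoc, mul_smul_comm, smul_smul,
          Complex.ofReal_mul]
      · simp [hgK t ht]
    rw [h2, Complex.ofReal_sub, Complex.ofReal_one, sub_smul, one_smul, sub_sub_cancel]
  refine ContinuousLinearMap.opNorm_le_bound _ hε.le fun x => ?_
  rw [h1, norm_smul, Complex.norm_real, Real.norm_of_nonneg (div_nonneg hε.le (hmax t).le)]
  have h3 : ‖fibreMap φ hφ t x‖ ≤ f t * ‖x‖ := by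
    rw [hf]
    exact (fibreMap φ hφ t).le_opNorm x
  calc ε / max (f t) ε * ‖fibreMap φ hφ t x‖ ≤ ε / max (f t) ε * (max (f t) ε * ‖x‖) := by
        refine mul_le_mul_of_nonneg_left (h3.trans ?_) (div_nonneg hε.le (hmax t).le)
        gcongr
        exact le_max_left _ _
    _ = ε * ‖x‖ := by
        rw [← mul_assoc, div_mul_cancel₀ _ (hmax t).ne']

end Closure

end MatrixBundle

end

theorem theorem6p8 {X : Type*} [TopologicalSpace X] [T2Space X] [LocallyCompactSpace X]
    (n : ℕ) [NeZero n] (E : X → Type*) [∀ t, CStarAlgebra (E t)]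
    [TopologicalSpace (Bundle.TotalSpace (MatrixBundle.Mat n) E)]
    [FiberBundle (MatrixBundle.Mat n) E] [VectorBundle ℂ (MatrixBundle.Mat n) E]
    [MatrixBundle.IsMatrixBundle n E]
    (φ : MatrixBundle.Gamma₀ n E →L[ℂ] MatrixBundle.Gamma₀ n E) :
    φ ∈ closure (MatrixBundle.TM₀ n E) ↔
      ∃ hφ : φ ∈ MatrixBundle.IB n E,
        φ ∈ MatrixBundle.IB₀₁ n E ∧
        ∀ K : Set X, IsCompact K → K ⊆ MatrixBundle.coz φ hφ →
          MatrixBundle.IsTrivialOn n (MatrixBundle.lineBundle φ hφ) K := by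
  constructor
  · intro h
    have hφ : φ ∈ MatrixBundle.IB n E :=
      closure_minimal MatrixBundle.TM₀_subset_IB MatrixBundle.isClosed_IB h
    exact ⟨hφ, ⟨MatrixBundle.mem_IB₀_of_mem_closure h hφ,
      MatrixBundle.mem_IB₁_of_mem_closure h hφ⟩,
      fun K hK hKφ => MatrixBundle.isTrivialOn_of_mem_closure h hφ hK hKφ⟩
  · rintro ⟨hφ, h, hK⟩
    exact MatrixBundle.mem_closure_of_isTrivialOn hφ h hK
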